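/- Let $m,n$ be natural numbers. For an open set $G$ in some $\mathbb C^k$ and $q\in\partial G$, we say that $h(x)=x+o(\|x-q\|^3)$ as $x\to q$ non-tangentially in $G$ if, for every $\kappa>0$, $(h(x)-x)/\|x-q\|^3\to 0$ as $x\to q$ inside $\{x\in G:\ \|x-q\|\le\kappa\,\mathrm{dist}(x,\partial G)\}$. Let $D\subset\mathbb C^m$ be a domain and let $p\in\partial D$ be a point near which $\partial D$ is of class $C^1$. Assume that non-tangential Burns–Krantz rigidity holds at $p$: every holomorphic $g:D\to D$ with $g(z)=z+o(\|z-p\|^3)$ as $z\to p$ non-tangentially in $D$ is the identity. Let $\Omega=\bigcup_{z\in D}\{z\}\times\Omega_z\subset\mathbb C^m\times\mathbb C^n$ be a domain all of whose fibers $\Omega_z$, $z\in D$, are bounded complete Reinhardt domains in $\mathbb C^n$. Write $\Delta^n_r=\{w\in\mathbb C^n:|w_i|<r \text{ for all } i\}$. Assume that $\Omega$ satisfies the cone condition: there are a function $\delta:D\to(0,\infty)$ with $\Delta^n_{\delta(z)}\subset\Omega_z$ for all $z\in D$ and $\delta(z)\to0$ as $z\to p$ and, for all $z\in D$ and $w\in\Delta^n_{\delta(z)}$,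 a linear graph over $D$ through $(z,w)$ and $(p,0)$, $$D_{z,w}=\{(\zeta,A_{z,w}(\zeta-p)):\zeta\in D\},\qquad A_{z,w}:\mathbb C^m\to\mathbb C^n\ \text{complex linear},\quad A_{z,w}(z-p)=w,$$ such that $\Omega$ contains the cone $C_\delta=\bigcup\{D_{z,w}:z\in D,\ w\in\Delta^n_{\delta(z)}\}$ with end $(p,0)$. If $f:\Omega\to\Omega$ is holomorphic and $f(z,w)=(z,w)+o(\|(z-p,w)\|^3)$ as $(z,w)\to(p,0)$ non-tangentially in $\Omega$, then $f(z,w)=(z,w)$ for all $(z,w)\in\Omega$. -/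

import Mathlib

open Set Filter Topology Asymptotics

namespace BurnsKrantz

/-- A domain: a nonempty connected open set. -/
def IsDomainSet {E : Type*} [TopologicalSpace E] (D : Set E) : Prop :=
  IsOpen D ∧ IsConnected D

/-- The non-tangential approach region of aperture `κ` at a boundary point `q` of an open set `Ω`:
the points of `Ω` whose distance to `q` is at most `κ` times the distance to the complement of `Ω`
(which, for points of an open set, is the distance to the boundary). Replacing the norm by an
equivalent one only changes the apertures. -/
def approachRegion {E : Type*} [NormedAddCommGroup E] (Ω : Set E) (q : E) (κ : ℝ) : Set E :=
  {x ∈ Ω | ‖x - q‖ ≤ κ * Metric.infDist x Ωᶜ}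

/-- `f(x) = x + o(‖x - q‖ ^ k)` as `x → q` non-tangentially in `Ω`, that is, inside every
approach region. The condition is the same for equivalent norms. -/
def EqIdAddLittleONontangential {E : Type*} [NormedAddCommGroup E]
    (Ω : Set E) (q : E) (k : ℕ) (f : E → E) : Prop :=
  ∀ κ : ℝ, (fun x => f x - x) =o[𝓝[approachRegion Ω q κ] q] (fun x => ‖x - q‖ ^ k)

/-- Non-tangential Burns–Krantz rigidity of `D` at `p`: a holomorphic self-map `g` of `D` with
`g(z) = z + o(‖z - p‖ ^ 3)` as `z → p` non-tangentially is the identity of `D`. -/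
def NontangentialRigidityAt {E : Type*} [NormedAddCommGroup E] [NormedSpace ℂ E]
    (D : Set E) (p : E) : Prop :=
  ∀ g : E → E, DifferentiableOn ℂ g D → MapsTo g D D →
    EqIdAddLittleONontangential D p 3 g → ∀ z ∈ D, g z = z

/-- `D` has `C^1` boundary near `p`: in an open neighbourhood `U` of `p` it is the set where a
`C^1` real function with nowhere vanishing differential is negative. -/
def HasC1BoundaryNear {E : Type*} [NormedAddCommGroup E] [NormedSpace ℝ E]
    (D : Set E) (p : E) : Prop :=
  ∃ U : Set E, IsOpen U ∧ p ∈ U ∧ ∃ ρ : E → ℝ, ContDiffOn ℝ 1 ρ U ∧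
    (∀ x ∈ U, fderiv ℝ ρ x ≠ 0) ∧ D ∩ U = {x ∈ U | ρ x < 0}

/-- The open polydisc of radius `r` about the origin of `ℂ^n`. -/
def polydisc (n : ℕ) (r : ℝ) : Set (Fin n → ℂ) :=
  {w | ∀ i, ‖w i‖ < r}

/-- A bounded complete Reinhardt domain in `ℂ^n`. -/
def IsBoundedCompleteReinhardt {n : ℕ} (W : Set (Fin n → ℂ)) : Prop :=
  IsDomainSet W ∧ Bornology.IsBounded W ∧
    ∀ w ∈ W, ∀ w' : Fin n → ℂ, (∀ i, ‖w' i‖ ≤ ‖w i‖) → w' ∈ W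

/-- The fiber `Ω_z`. -/
def fiber {m n : ℕ} (Ω : Set ((Fin m → ℂ) × (Fin n → ℂ))) (z : Fin m → ℂ) : Set (Fin n → ℂ) :=
  {w | (z, w) ∈ Ω}

/-- `Ω` is a domain in `ℂ^m × ℂ^n` lying over `D`, all of whose fibers over the points of `D` are
bounded complete Reinhardt domains. -/
def IsReinhardtFibered {m n : ℕ} (D : Set (Fin m → ℂ))
    (Ω : Set ((Fin m → ℂ) × (Fin n → ℂ))) : Prop :=
  IsDomainSet Ω ∧ (∀ x ∈ Ω, x.1 ∈ D) ∧ ∀ z ∈ D, IsBoundedCompleteReinhardt (fiber Ω z)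

/-- The linear graph over `D` through `(p, 0)` with linear part `A`. -/
def linearGraph {m n : ℕ} (D : Set (Fin m → ℂ)) (p : Fin m → ℂ)
    (A : (Fin m → ℂ) →ₗ[ℂ] (Fin n → ℂ)) : Set ((Fin m → ℂ) × (Fin n → ℂ)) :=
  {x | x.1 ∈ D ∧ x.2 = A (x.1 - p)}

/-- The cone with end `(p, 0)` of size `δ`: the union of the graphs `D_{z,w}`, `z ∈ D`,
`w` in the polydisc of radius `δ z`, where `D_{z,w}` has linear part `A z w`. -/
def cone {m n : ℕ} (D : Set (Fin m → ℂ)) (p : Fin m → ℂ) (δ : (Fin m → ℂ) → ℝ)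
    (A : (Fin m → ℂ) → (Fin n → ℂ) → ((Fin m → ℂ) →ₗ[ℂ] (Fin n → ℂ))) :
    Set ((Fin m → ℂ) × (Fin n → ℂ)) :=
  {x | ∃ z ∈ D, ∃ w ∈ polydisc n (δ z), x ∈ linearGraph D p (A z w)}

/-- The cone condition: `Ω` contains a cone with end `(p, 0)`. The graph `D_{z,w}` passes through
`(z, w)`, i.e. `A z w (z - p) = w`. For `m = 1` this determines it; for `m ≥ 2` there are several
linear graphs through `(z, w)` and `(p, 0)`, and any choice of them is allowed. -/
def SatisfiesConeCondition {m n : ℕ} (D : Set (Fin m → ℂ)) (p : Fin m → ℂ)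
    (Ω : Set ((Fin m → ℂ) × (Fin n → ℂ))) : Prop :=
  ∃ δ : (Fin m → ℂ) → ℝ,
    (∀ z ∈ D, 0 < δ z) ∧
    (∀ z ∈ D, polydisc n (δ z) ⊆ fiber Ω z) ∧
    Tendsto δ (𝓝[D] p) (𝓝 0) ∧
    ∃ A : (Fin m → ℂ) → (Fin n → ℂ) → ((Fin m → ℂ) →ₗ[ℂ] (Fin n → ℂ)),
      (∀ z ∈ D, ∀ w ∈ polydisc n (δ z), A z w (z - p) = w) ∧
      cone D p δ A ⊆ Ω

end BurnsKrantz

/-! Base component: completeness of the fibers fattens a linear graph `w = A (ζ - p)` of the cone to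
the set `‖w i‖ ≤ ‖A (ζ - p) i‖`, still inside `Ω`. For `‖s i‖ ≤ 1 / 2` the map `ζ ↦ (f (ζ, s * A (ζ
- p))).1` is a self-map of `D`; if it has third order contact with the identity at `p`, rigidity
makes it the identity. These graphs sweep out an open set, so `f` preserves every fiber. The
difficulty is that near zeros of a coordinate of `A (ζ - p)` the graph may leave all approach
regions of `Ω`. The contact estimate is therefore proved on circles avoiding these zeros and carried
to their centres by the maximum principle (`eqIdAddLittleONontangential_graph`).

Fiber component: let `φ σ` be a diagonal derivative at `w = 0` of the fiber map over `p + σ • ν`. It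
is holomorphic in `σ`, and `‖φ‖ ≤ 1` because the fibers are complete Reinhardt. Cauchy's estimate on
circles of radius comparable to `τ` costs one order: `φ τ = 1 + o(τ ^ 2)`. The `C^1` boundary
provides a sector of opening `π / 2`; a square root pulls it back to a disc and turns `o(τ ^ 2)`
into `o(t)`, so a Hopf type lemma gives `φ = 1` (`deriv_snd_eq_one_of_sector`).

The derivative of the fiber map at the origin then has trace `n` and bounded powers, hence is the
identity, and Cartan's theorem makes the fiber map the identity
(`IsBoundedCompleteReinhardt.eqOn_id_of_deriv_eq_one`). This holds over an open set of base points;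
the identity principle concludes. -/

namespace BurnsKrantz

/-! ### Identity principle and one-variable lemmas of Schwarz type -/

/-- The identity principle for holomorphic maps on a connected open subset of a normed space. -/
theorem eqOn_of_isPreconnected_of_eventuallyEq {E F : Type*} [NormedAddCommGroup E]
    [NormedSpace ℂ E] [NormedAddCommGroup F] [NormedSpace ℂ F] [CompleteSpace F]
    {U : Set E} (hU : IsOpen U) (hUc : IsPreconnected U) {f g : E → F}
    (hf : DifferentiableOn ℂ f U) (hg : DifferentiableOn ℂ g U) {x₀ : E} (hx₀ : x₀ ∈ U)
    (h : f =ᶠ[𝓝 x₀] g) : EqOn f g U := by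
  set S : Set E := {x | f =ᶠ[𝓝 x] g} with hS
  have hSo : IsOpen S := isOpen_setOfPred_eventually_nhds
  have key : U ⊆ S := by
    refine hUc.subset_of_closure_inter_subset hSo ⟨x₀, hx₀, h⟩ ?_
    rintro x ⟨hxc, hxU⟩
    obtain ⟨r, hr, hrU⟩ := Metric.isOpen_iff.1 hU x hxU
    obtain ⟨y, hyS, hxy⟩ := Metric.mem_closure_iff.1 hxc (r / 2) (by positivity)
    have hyball : Metric.ball y (r / 2) ⊆ U := by
      refine Subset.trans (Metric.ball_subset_ball' ?_) hrU
      rw [dist_comm] at hxy; linarith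
    -- The complex line through `y` and `z` meets the ball in a convex plane set, where the
    -- one-variable identity theorem applies.
    have hz : ∀ z ∈ Metric.ball y (r / 2), f z = g z := by
      intro z hz
      set l : ℂ → E := fun t => y + t • (z - y) with hl
      have hlc : Continuous l := by fun_prop
      have hld : Differentiable ℂ l := by fun_prop
      set V : Set ℂ := l ⁻¹' Metric.ball y (r / 2) with hV
      have hVo : IsOpen V := Metric.isOpen_ball.preimage hlc
      have hV' : V = {t : ℂ | ‖t‖ * ‖z - y‖ < r / 2} := by
        ext t; simp [hV, hl, norm_smul]
      have hVc : IsPreconnected V := by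
        refine Convex.isPreconnected fun s hs t ht a b ha hb hab => ?_
        have e : l (a • s + b • t) = a • l s + b • l t := by
          have : y = a • y + b • y := by rw [← add_smul, hab, one_smul]
          simp only [hl, add_smul, smul_add, smul_assoc]
          nth_rw 1 [this]
          abel
        rw [hV, mem_preimage, e]
        exact convex_ball y (r / 2) hs ht ha hb hab
      have hmaps : MapsTo l V U := fun t ht => hyball ht
      have h1 : AnalyticOnNhd ℂ (f ∘ l) V :=
        (hf.comp hld.differentiableOn hmaps).analyticOnNhd hVo
      have h2 : AnalyticOnNhd ℂ (g ∘ l) V :=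
        (hg.comp hld.differentiableOn hmaps).analyticOnNhd hVo
      have h0V : (0 : ℂ) ∈ V := by
        rw [hV']; simp; positivity
      have h1V : (1 : ℂ) ∈ V := by
        rw [hV']; simpa [dist_eq_norm] using hz
      have hev : f ∘ l =ᶠ[𝓝 0] g ∘ l := by
        have : Tendsto l (𝓝 0) (𝓝 y) := by simpa [hl] using hlc.tendsto 0
        exact this.eventually hyS
      have := h1.eqOn_of_preconnected_of_eventuallyEq h2 hVc h0V hev h1V
      simpa [hl] using this
    exact Filter.eventuallyEq_of_mem (Metric.isOpen_ball.mem_nhds hxy) hz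
  intro x hx
  exact (key hx).self_of_nhds

/-- A boundary point lemma of Hopf type: a holomorphic function on the unit disc with nonnegative
real part that vanishes to order greater than one at the boundary point `1` along the radius is
purely imaginary at the centre. -/
theorem re_eq_zero_of_isLittleO {G : ℂ → ℂ} (hG : DifferentiableOn ℂ G (Metric.ball 0 1))
    (hre : ∀ x ∈ Metric.ball (0 : ℂ) 1, 0 ≤ (G x).re)
    (ho : (fun t : ℝ => G (1 - t)) =o[𝓝[>] 0] (fun t : ℝ => t)) : (G 0).re = 0 := by
  have h0 := hre 0 (by simp)
  by_contra hne
  have hb : 0 < (G 0).re := lt_of_le_of_ne h0 (Ne.symm hne)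
  set b := G 0 with hbdef
  have hden : ∀ x ∈ Metric.ball (0 : ℂ) 1, G x + (starRingEnd ℂ) b ≠ 0 := by
    intro x hx h
    have := congrArg Complex.re h
    simp at this
    linarith [hre x hx]
  -- Cayley transform of the right half-plane sending `b` to `0`. Schwarz gives `‖Q (1 - t)‖ ≤ 1 -
  -- t`, while `‖G (1 - t)‖ ≤ t * ‖b‖ / 4` forces `‖Q (1 - t)‖ ≥ (1 - t / 4) / (1 + t / 4) > 1 - t`.
  set Q : ℂ → ℂ := fun x => (G x - b) / (G x + (starRingEnd ℂ) b) with hQ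
  have hQd : DifferentiableOn ℂ Q (Metric.ball 0 1) :=
    (hG.sub_const b).div (hG.add_const _) hden
  have hQ0 : Q 0 = 0 := by simp [hQ, hbdef]
  have hQm : MapsTo Q (Metric.ball 0 1) (Metric.closedBall 0 1) := by
    intro x hx
    rw [mem_closedBall_zero_iff, hQ]
    simp only [norm_div]
    rw [div_le_one (norm_pos_iff.2 (hden x hx))]
    rw [← sq_le_sq₀ (norm_nonneg _) (norm_nonneg _), ← Complex.normSq_eq_norm_sq,
      ← Complex.normSq_eq_norm_sq, Complex.normSq_apply, Complex.normSq_apply]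
    simp
    nlinarith [hre x hx]
  have hbn : 0 < ‖b‖ := norm_pos_iff.2 (by intro h; rw [h] at hb; simp at hb)
  have hev := ho.bound (show 0 < ‖b‖ / 4 by positivity)
  have hev2 : ∀ᶠ t : ℝ in 𝓝[>] 0, t ∈ Ioo (0 : ℝ) 1 := Ioo_mem_nhdsGT one_pos
  obtain ⟨t, ht, ht0, ht1⟩ := (hev.and hev2).exists
  have hx : ‖((1 : ℂ) - t)‖ = 1 - t := by
    have : (1 : ℂ) - t = ((1 - t : ℝ) : ℂ) := by push_cast; ring
    rw [this, Complex.norm_real, Real.norm_of_nonneg (by linarith)]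
  have hxb : (1 : ℂ) - t ∈ Metric.ball (0 : ℂ) 1 := by
    rw [mem_ball_zero_iff, hx]; linarith
  have hs := Complex.norm_le_norm_of_mapsTo_ball hQd hQm hQ0 (z := (1 : ℂ) - t) (by rw [hx]; linarith)
  rw [hx, hQ] at hs
  simp only [norm_div] at hs
  rw [div_le_iff₀ (norm_pos_iff.2 (hden _ hxb))] at hs
  have e1 : ‖b‖ - ‖G (1 - t)‖ ≤ ‖G (1 - t) - b‖ := by
    rw [norm_sub_rev]; exact norm_sub_norm_le _ _
  have e2 : ‖G (1 - t) + (starRingEnd ℂ) b‖ ≤ ‖G (1 - t)‖ + ‖b‖ := by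
    simpa using norm_add_le (G (1 - t)) ((starRingEnd ℂ) b)
  rw [Real.norm_of_nonneg ht0.le] at ht
  have hg0 := norm_nonneg (G (1 - t))
  have e3 : (1 - t) * ‖G (1 - t) + (starRingEnd ℂ) b‖ ≤ (1 - t) * (‖G (1 - t)‖ + ‖b‖) := by
    gcongr
  nlinarith [mul_pos ht0 hbn]

/-- A holomorphic self-map of a disc whose derivative at the centre is `1` fixes the centre. -/
theorem eq_zero_of_mapsTo_ball_of_deriv_eq_one {k : ℂ → ℂ} {R : ℝ} (hR : 0 < R)
    (hk : DifferentiableOn ℂ k (Metric.ball 0 R))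
    (hm : MapsTo k (Metric.ball 0 R) (Metric.ball 0 R)) (hd : deriv k 0 = 1) : k 0 = 0 := by
  set a := k 0 with ha
  have h0 : (0 : ℂ) ∈ Metric.ball (0 : ℂ) R := by simpa using hR
  have haR : ‖a‖ < R := by simpa using hm h0
  have hden : ∀ t ∈ Metric.ball (0 : ℂ) R, (R : ℂ) ^ 2 - (starRingEnd ℂ) a * k t ≠ 0 := by
    intro t ht h
    have hkt : ‖k t‖ < R := by simpa using hm ht
    have := congrArg norm (sub_eq_zero.1 h)
    simp [abs_of_pos hR] at this
    nlinarith [norm_nonneg a, norm_nonneg (k t)]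
  -- The automorphism of the disc of radius `R` moving `a` to `0`, applied after `k`. Its derivative
  -- at `0` is `R ^ 2 / (R ^ 2 - ‖a‖ ^ 2)`, which Schwarz bounds by `1`, so `a = 0`.
  set ψ : ℂ → ℂ := fun t => (R : ℂ) ^ 2 * (k t - a) / ((R : ℂ) ^ 2 - (starRingEnd ℂ) a * k t) with hψ
  have hψd : DifferentiableOn ℂ ψ (Metric.ball 0 R) :=
    ((hk.sub_const a).const_mul _).div ((hk.const_mul _).const_sub _) hden
  have hψ0 : ψ 0 = 0 := by simp [hψ, ha]
  have hψm : MapsTo ψ (Metric.ball 0 R) (Metric.closedBall (ψ 0) R) := by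
    intro t ht
    have hkt : ‖k t‖ < R := by simpa using hm ht
    rw [hψ0, mem_closedBall_zero_iff, hψ]
    simp only [norm_div]
    rw [div_le_iff₀ (norm_pos_iff.2 (hden t ht))]
    rw [norm_mul, norm_pow, Complex.norm_real, Real.norm_of_nonneg hR.le, pow_two, mul_assoc]
    gcongr
    rw [← sq_le_sq₀ (by positivity) (norm_nonneg _), mul_pow, ← Complex.normSq_eq_norm_sq,
      ← Complex.normSq_eq_norm_sq]
    have e1 : ‖k t‖ ^ 2 ≤ R ^ 2 := by gcongr
    have e2 : ‖a‖ ^ 2 ≤ R ^ 2 := by gcongr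
    rw [← Complex.normSq_eq_norm_sq, Complex.normSq_apply] at e1 e2
    rw [Complex.normSq_apply, Complex.normSq_apply]
    have e3 : (((R : ℂ) ^ 2)).re = R ^ 2 := by rw [← Complex.ofReal_pow, Complex.ofReal_re]
    have e4 : (((R : ℂ) ^ 2)).im = 0 := by rw [← Complex.ofReal_pow, Complex.ofReal_im]
    simp only [Complex.sub_re, Complex.sub_im, Complex.mul_re, Complex.mul_im, Complex.conj_re,
      Complex.conj_im, e3, e4]
    nlinarith [mul_nonneg (sub_nonneg.2 e1) (sub_nonneg.2 e2)]
  have hle := Complex.norm_deriv_le_one_of_mapsTo_ball hψd hψm hR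
  have hkd : HasDerivAt k 1 0 := by
    rw [← hd]; exact (hk.differentiableAt (Metric.isOpen_ball.mem_nhds h0)).hasDerivAt
  have hψ' : HasDerivAt ψ ((R : ℂ) ^ 2 / ((R : ℂ) ^ 2 - (starRingEnd ℂ) a * a)) 0 := by
    have hn := (hkd.sub_const a).const_mul ((R : ℂ) ^ 2)
    have hdn := (hkd.const_mul ((starRingEnd ℂ) a)).const_sub ((R : ℂ) ^ 2)
    have := hn.div hdn (hden 0 h0)
    have hne := hden 0 h0
    rw [← ha] at this hne
    have e : (R : ℂ) ^ 2 / ((R : ℂ) ^ 2 - (starRingEnd ℂ) a * a) =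
        ((R : ℂ) ^ 2 * 1 * ((R : ℂ) ^ 2 - (starRingEnd ℂ) a * a) -
          (R : ℂ) ^ 2 * (a - a) * -((starRingEnd ℂ) a * 1)) /
            ((R : ℂ) ^ 2 - (starRingEnd ℂ) a * a) ^ 2 := by
      field_simp
      ring
    rw [e]
    exact this
  rw [hψ'.deriv] at hle
  have e : (R : ℂ) ^ 2 - (starRingEnd ℂ) a * a = ((R ^ 2 - ‖a‖ ^ 2 : ℝ) : ℂ) := by
    rw [mul_comm, Complex.mul_conj, Complex.normSq_eq_norm_sq]; push_cast; ring
  have hpos : 0 < R ^ 2 - ‖a‖ ^ 2 := by nlinarith [norm_nonneg a]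
  rw [e, norm_div, norm_pow, Complex.norm_real, Complex.norm_real, Real.norm_of_nonneg hR.le,
    Real.norm_of_nonneg hpos.le, div_le_one hpos] at hle
  have : ‖a‖ ^ 2 ≤ 0 := by linarith
  have : ‖a‖ = 0 := by nlinarith [norm_nonneg a, sq_nonneg ‖a‖]
  exact norm_eq_zero.1 this

/-! ### Power-bounded operators and Cartan's uniqueness theorem -/

/-- An operator with bounded powers is the identity if its trace equals the dimension. -/
theorem eq_one_of_norm_pow_le_of_trace_eq {E : Type*} [NormedAddCommGroup E] [NormedSpace ℂ E]
    [FiniteDimensional ℂ E] (T : E →L[ℂ] E) {C : ℝ} (hC : ∀ k : ℕ, ‖T ^ k‖ ≤ C)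
    (htr : LinearMap.trace ℂ E (T : E →ₗ[ℂ] E) = Module.finrank ℂ E) : T = 1 := by
  set t : Module.End ℂ E := (T : E →ₗ[ℂ] E) with ht
  have hsplit : t.charpoly.Splits := IsAlgClosed.splits _
  have hpow : ∀ (k : ℕ) (v : E), (t ^ k) v = (T ^ k) v := by
    intro k
    induction k with
    | zero => intro v; simp
    | succ k ih => intro v; rw [pow_succ, pow_succ]; exact ih (T v)
  have hle : ∀ μ ∈ t.charpoly.roots, ‖μ‖ ≤ 1 := by
    intro μ hμ
    have hev : t.HasEigenvalue μ :=
      Module.End.hasEigenvalue_iff_isRoot_charpoly t μ |>.2 (Polynomial.isRoot_of_mem_roots hμ)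
    obtain ⟨v, hv⟩ := hev.exists_hasEigenvector
    by_contra hlt
    push Not at hlt
    obtain ⟨k, hk⟩ := pow_unbounded_of_one_lt C hlt
    have h1 : (T ^ k) v = μ ^ k • v := by rw [← hpow, hv.pow_apply]
    have h2 := (T ^ k).le_opNorm v
    rw [h1, norm_smul, norm_pow] at h2
    have hvpos : 0 < ‖v‖ := norm_pos_iff.2 hv.2
    have := le_of_mul_le_mul_right h2 hvpos
    linarith [hC k]
  have hcard : t.charpoly.roots.card = Module.finrank ℂ E := by
    rw [← hsplit.natDegree_eq_card_roots, LinearMap.charpoly_natDegree]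
  have hsum : t.charpoly.roots.sum = (t.charpoly.roots.card : ℂ) := by
    rw [← Module.End.trace_eq_sum_roots_charpoly_of_splits hsplit, htr, hcard]
  -- Equality case of the triangle inequality: the real parts are at most `1` and average to `1`.
  have hall : ∀ s : Multiset ℂ, (∀ μ ∈ s, ‖μ‖ ≤ 1) → s.sum = (s.card : ℂ) → ∀ μ ∈ s, μ = 1 := by
    intro s hs hsum μ hμ
    obtain ⟨s', rfl⟩ := Multiset.exists_cons_of_mem hμ
    have hs' : ‖s'.sum‖ ≤ s'.card := by
      have h := Multiset.le_sum_of_subadditive (fun z : ℂ => ‖z‖) norm_zero.le norm_add_le s'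
      refine h.trans ?_
      have := Multiset.sum_le_card_nsmul (s'.map fun z : ℂ => ‖z‖) 1 (by
        intro x hx
        obtain ⟨z, hz, rfl⟩ := Multiset.mem_map.1 hx
        exact hs z (Multiset.mem_cons_of_mem hz))
      simpa using this
    have h1 := hs μ (Multiset.mem_cons_self _ _)
    have hre := congrArg Complex.re hsum
    simp at hre
    have h2 : s'.sum.re ≤ s'.card := (Complex.re_le_norm _).trans hs'
    have h3 : 1 ≤ μ.re := by linarith
    have h4 : μ.re ≤ ‖μ‖ := Complex.re_le_norm _
    have h5 : μ.re = 1 := by linarith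
    have h6 : ‖μ‖ ^ 2 ≤ 1 := by nlinarith [norm_nonneg μ]
    rw [← Complex.normSq_eq_norm_sq, Complex.normSq_apply, h5] at h6
    have h7 : μ.im = 0 := by nlinarith [mul_self_nonneg μ.im]
    exact Complex.ext (by simpa using h5) (by simpa using h7)
  have hone := hall _ hle hsum
  have hnil : (t - 1) ^ Module.finrank ℂ E = 0 := by
    have hcp : t.charpoly = (Polynomial.X - Polynomial.C 1) ^ Module.finrank ℂ E := by
      have h := hsplit.eq_prod_roots_of_monic (LinearMap.charpoly_monic t)
      rw [Multiset.eq_replicate_card.2 hone, hcard] at h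
      simpa using h
    have := LinearMap.aeval_self_charpoly t
    rw [hcp] at this
    simpa using this
  have hTnil : ∃ d : ℕ, (T - 1) ^ d = 0 := by
    refine ⟨Module.finrank ℂ E, ?_⟩
    ext v
    have hp : ∀ (k : ℕ) (v : E), ((t - 1) ^ k) v = ((T - 1) ^ k) v := by
      intro k
      induction k with
      | zero => intro v; simp
      | succ k ih => intro v; rw [pow_succ, pow_succ]; exact ih ((T - 1) v)
    rw [← hp, hnil]; simp
  classical
  set d := Nat.find hTnil with hd
  have hd0 : (T - 1) ^ d = 0 := Nat.find_spec hTnil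
  have hdmin : ∀ e < d, (T - 1) ^ e ≠ 0 := fun e he => Nat.find_min hTnil he
  rcases Nat.lt_or_ge d 2 with hlt | hge
  · have h1 : (T - 1) ^ 1 = 0 := by
      have : d ≤ 1 := by omega
      exact pow_eq_zero_of_le this hd0
    rw [pow_one] at h1
    exact sub_eq_zero.1 h1
  · exfalso
    -- With `N ^ (e + 2) = 0` but `N ^ (e + 1) ≠ 0`, the product `T ^ k * N ^ e = N ^ e + k • N ^ (e
    -- + 1)` grows linearly in `k`, against the bounded powers.
    obtain ⟨e, he⟩ : ∃ e, d = e + 2 := ⟨d - 2, by omega⟩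
    set N := T - 1 with hN
    have hT : T = 1 + N := by rw [hN]; abel
    have hk : ∀ k : ℕ, T ^ k * N ^ e = N ^ e + k • N ^ (e + 1) := by
      intro k
      induction k with
      | zero => simp
      | succ k ih =>
        have hz : N * N ^ (e + 1) = 0 := by rw [← pow_succ', ← hd0, he]
        rw [pow_succ', mul_assoc, ih, mul_add, mul_smul_comm, hT, add_mul, add_mul, hz, one_mul,
          one_mul, ← pow_succ', add_zero, succ_nsmul]
        abel
    have hpos : 0 < ‖N ^ (e + 1)‖ := norm_pos_iff.2 (hdmin _ (by omega))
    obtain ⟨k, hk'⟩ := exists_nat_gt (((C + 1) * ‖N ^ e‖) / ‖N ^ (e + 1)‖)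
    rw [div_lt_iff₀ hpos] at hk'
    have h1 : k • N ^ (e + 1) = T ^ k * N ^ e - N ^ e := by rw [hk k]; abel
    have h2 : ‖k • N ^ (e + 1)‖ = k * ‖N ^ (e + 1)‖ := by
      rw [← Nat.cast_smul_eq_nsmul ℂ, norm_smul]; simp
    have h3 : ‖T ^ k * N ^ e - N ^ e‖ ≤ C * ‖N ^ e‖ + ‖N ^ e‖ := by
      refine (norm_sub_le _ _).trans ?_
      gcongr
      refine (norm_mul_le _ _).trans ?_
      gcongr
      exact hC k
    rw [← h1, h2] at h3
    linarith

/-- **Cartan's uniqueness theorem** (local form): a holomorphic self-map of a bounded open set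
that agrees to first order with the identity at a fixed point is the identity near it. -/
theorem eventually_eq_id_of_fderiv_eq_one {E : Type*} [NormedAddCommGroup E] [NormedSpace ℂ E]
    {W : Set E} (hW : IsOpen W) (hWb : Bornology.IsBounded W) (h0 : (0 : E) ∈ W) {h : E → E}
    (hd : DifferentiableOn ℂ h W) (hm : MapsTo h W W) (hfix : h 0 = 0)
    (hone : HasFDerivAt h (ContinuousLinearMap.id ℂ E) 0) : h =ᶠ[𝓝 0] id := by
  obtain ⟨r, hr, hrW⟩ := Metric.isOpen_iff.1 hW 0 h0
  obtain ⟨M, hMpos, hM⟩ := hWb.exists_pos_norm_le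
  set e : E → E := fun y => h y - y with he
  have hit_m : ∀ j : ℕ, MapsTo h^[j] W W := fun j => hm.iterate j
  have hit_d : ∀ j : ℕ, DifferentiableOn ℂ h^[j] W := fun j => by
    induction j with
    | zero => exact differentiableOn_id
    | succ j ih => rw [Function.iterate_succ']; exact hd.comp ih (hit_m j)
  have hit_0 : ∀ j : ℕ, h^[j] 0 = 0 := fun j => Function.iterate_fixed hfix j
  -- Higher order Schwarz estimate. The constant is independent of `j`, since all iterates stay in
  -- the bounded set `W`.
  have hbnd : ∀ (j : ℕ) (k : ℕ), (fun y => h^[j] y - y) =o[𝓝 0] (fun y => ‖y‖ ^ k) →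
      ∀ y ∈ Metric.ball (0 : E) r, ‖h^[j] y - y‖ ≤ (2 * M) * (‖y‖ / r) ^ (k + 1) := by
    intro j k ho y hy
    have := Complex.dist_le_mul_div_pow_of_mapsTo_ball_of_isLittleO (f := fun y => h^[j] y - y)
      (c := (0 : E)) (z := y) (R₁ := r) (R₂ := 2 * M) (n := k)
      (((hit_d j).mono hrW).sub differentiableOn_id) ?_ (by simpa [hit_0] using ho) hy
    · simpa [hit_0] using this
    · intro x hx
      simp only [hit_0, sub_zero, mem_closedBall_zero_iff]
      refine (norm_sub_le _ _).trans ?_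
      have := hM _ (hit_m j (hrW hx))
      have := hM _ (hrW hx)
      linarith
  -- the order of vanishing of `h - id` at the origin is arbitrarily large
  have main : ∀ k : ℕ, e =o[𝓝 0] (fun y : E => ‖y‖ ^ (k + 1)) := by
    intro k
    induction k with
    | zero =>
      have := hone.isLittleO
      simpa [hfix, he] using this.norm_right
    | succ k ih =>
      have hebnd : ∀ y ∈ Metric.ball (0 : E) r, ‖e y‖ ≤ (2 * M) * (‖y‖ / r) ^ (k + 2) := by
        intro y hy
        have := hbnd 1 (k + 1) (by simpa using ih) y hy
        simpa using this
      set c := 2 * M / r ^ (k + 2) with hc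
      have hcpos : 0 < c := by positivity
      have hebnd' : ∀ y ∈ Metric.ball (0 : E) r, ‖e y‖ ≤ c * ‖y‖ ^ (k + 2) := by
        intro y hy
        refine (hebnd y hy).trans_eq ?_
        rw [div_pow, hc]; ring
      have hed : DifferentiableOn ℂ e (Metric.ball 0 r) := (hd.mono hrW).sub differentiableOn_id
      -- The Schwarz lemma on the ball of radius `‖y‖` about `y`, where `‖e‖ ≤ c * (2 * ‖y‖) ^ (k +
      -- 2)`, stands in for a bound on the derivative of `e`.
      have hlip : ∀ y y' : E, 2 * ‖y‖ < r → ‖y' - y‖ < ‖y‖ →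
          ‖e y' - e y‖ ≤ (2 * c * 2 ^ (k + 2)) * ‖y‖ ^ (k + 1) * ‖y' - y‖ := by
        intro y y' hy hyy'
        have hypos : 0 < ‖y‖ := (norm_nonneg _).trans_lt hyy'
        have hsub : ∀ x ∈ Metric.ball y ‖y‖, ‖x‖ < 2 * ‖y‖ := by
          intro x hx
          rw [mem_ball_iff_norm] at hx
          have := norm_le_insert' x y
          linarith
        have hb : ∀ x ∈ Metric.ball y ‖y‖, ‖e x‖ ≤ c * (2 * ‖y‖) ^ (k + 2) := by
          intro x hx
          have h2 := hsub x hx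
          refine (hebnd' x (by rw [mem_ball_zero_iff]; linarith)).trans ?_
          gcongr
        have := Complex.dist_le_div_mul_dist_of_mapsTo_ball (f := e) (c := y) (z := y')
          (R₁ := ‖y‖) (R₂ := 2 * (c * (2 * ‖y‖) ^ (k + 2)))
          (hed.mono fun x hx => by rw [mem_ball_zero_iff]; linarith [hsub x hx]) (by
            intro x hx
            rw [mem_closedBall_iff_norm]
            refine (norm_sub_le _ _).trans ?_
            linarith [hb x hx, hb y (Metric.mem_ball_self hypos)])
          (by rwa [mem_ball_iff_norm])
        rw [dist_eq_norm, dist_eq_norm] at this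
        refine this.trans_eq ?_
        field_simp
        ring
      -- To leading order the `j`-th iterate is `y + j • e y`: each iteration adds `e (h^[j] y)`,
      -- which differs from `e y` by `O(‖y‖ ^ (2 * k + 3))`.
      have ho : ∀ j : ℕ, (fun y => h^[j] y - y - (j : ℂ) • e y) =o[𝓝 0]
            (fun y : E => ‖y‖ ^ (k + 1 + 1)) ∧
          (fun y => h^[j] y - y) =o[𝓝 0] (fun y : E => ‖y‖ ^ (k + 1)) := by
        intro j
        induction j with
        | zero => simp
        | succ j ihj =>
          obtain ⟨ih1, ih2⟩ := ihj
          have hb := hbnd j (k + 1) ih2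
          have key : (fun y => e (h^[j] y) - e y) =o[𝓝 0] (fun y : E => ‖y‖ ^ (k + 1 + 1)) := by
            have hO : (fun y => e (h^[j] y) - e y) =O[𝓝 0]
                (fun y : E => ‖y‖ ^ (k + 1) * ‖y‖ ^ (k + 2)) := by
              have hsmall : ∀ᶠ y in 𝓝 (0 : E), c * ‖y‖ ^ (k + 1) < 1 := by
                have : Tendsto (fun y : E => c * ‖y‖ ^ (k + 1)) (𝓝 0) (𝓝 (c * ‖(0 : E)‖ ^ (k + 1))) :=
                  Continuous.tendsto (by fun_prop) 0
                exact this.eventually (gt_mem_nhds (by simp))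
              refine IsBigO.of_bound ((2 * c * 2 ^ (k + 2)) * c) ?_
              filter_upwards [Metric.ball_mem_nhds (0 : E) (show 0 < r / 2 by positivity), hsmall]
                with y hy hys
              rw [mem_ball_zero_iff] at hy
              have h1 : ‖h^[j] y - y‖ ≤ c * ‖y‖ ^ (k + 2) := by
                refine (hb y (by rw [mem_ball_zero_iff]; linarith)).trans_eq ?_
                rw [div_pow, hc]; ring
              rcases eq_or_ne y 0 with rfl | hy0
              · simp [hit_0]
              have hypos : 0 < ‖y‖ := norm_pos_iff.2 hy0
              have h2 := hlip y (h^[j] y) (by linarith) (h1.trans_lt (by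
                rw [pow_succ, ← mul_assoc]
                nlinarith))
              refine h2.trans ?_
              rw [Real.norm_of_nonneg (by positivity)]
              calc _ ≤ (2 * c * 2 ^ (k + 2)) * ‖y‖ ^ (k + 1) * (c * ‖y‖ ^ (k + 2)) := by gcongr
                _ = _ := by ring
            refine hO.trans_isLittleO ?_
            have hz : (fun y : E => ‖y‖ ^ (k + 1)) =o[𝓝 0] (fun _ => (1 : ℝ)) := by
              rw [isLittleO_one_iff]
              have : Tendsto (fun y : E => ‖y‖ ^ (k + 1)) (𝓝 0) (𝓝 (‖(0 : E)‖ ^ (k + 1))) :=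
                Continuous.tendsto (by fun_prop) 0
              simpa using this
            simpa using hz.mul_isBigO (isBigO_refl (fun y : E => ‖y‖ ^ (k + 1 + 1)) (𝓝 0))
          have hlow : (fun y : E => ‖y‖ ^ (k + 1 + 1)) =O[𝓝 0] (fun y : E => ‖y‖ ^ (k + 1)) := by
            refine IsBigO.of_bound 1 ?_
            filter_upwards [Metric.ball_mem_nhds (0 : E) one_pos] with y hy
            rw [mem_ball_zero_iff] at hy
            rw [Real.norm_of_nonneg (by positivity), Real.norm_of_nonneg (by positivity), one_mul]
            exact pow_le_pow_of_le_one (norm_nonneg _) hy.le (by omega)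
          constructor
          · refine (ih1.add key).congr_left fun y => ?_
            rw [Function.iterate_succ_apply']
            simp only [he, Nat.cast_succ, add_smul, one_smul]
            abel
          · refine ((ih2.add (key.trans_isBigO hlow)).add ih).congr_left fun y => ?_
            rw [Function.iterate_succ_apply']
            simp only [he]
            abel
      rw [isLittleO_iff]
      intro ε hε
      -- The bound on `j • e y` does not depend on `j`; dividing by a large `j` makes the constant
      -- smaller than `ε`.
      obtain ⟨j, hj⟩ := exists_nat_gt ((c + 1) / ε)
      have hjpos : 0 < (j : ℝ) := lt_of_le_of_lt (by positivity) hj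
      rw [div_lt_iff₀ hε] at hj
      obtain ⟨ho1, ho2⟩ := ho j
      filter_upwards [ho1.bound one_pos, Metric.ball_mem_nhds (0 : E) hr] with y hy hyr
      have h1 : ‖h^[j] y - y‖ ≤ c * ‖y‖ ^ (k + 2) := by
        refine (hbnd j (k + 1) ho2 y hyr).trans_eq ?_
        rw [div_pow, hc]; ring
      rw [Real.norm_of_nonneg (by positivity)] at hy ⊢
      have h2 : ‖(j : ℂ) • e y‖ ≤ (c + 1) * ‖y‖ ^ (k + 2) := by
        have : (j : ℂ) • e y = (h^[j] y - y) - (h^[j] y - y - (j : ℂ) • e y) := by abel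
        rw [this]
        refine (norm_sub_le _ _).trans ?_
        rw [add_mul]
        exact add_le_add h1 hy
      rw [norm_smul, Complex.norm_natCast] at h2
      have h3 : (j : ℝ) * ‖e y‖ ≤ j * (ε * ‖y‖ ^ (k + 1 + 1)) := by
        refine h2.trans ?_
        rw [← mul_assoc]
        gcongr
      exact le_of_mul_le_mul_left h3 hjpos
  filter_upwards [Metric.ball_mem_nhds (0 : E) hr] with y hy
  have hlt : ‖y‖ / r < 1 := by rw [div_lt_one hr]; simpa using hy
  have hle : ∀ k : ℕ, ‖e y‖ ≤ (2 * M) * (‖y‖ / r) ^ (k + 2) := fun k => by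
    simpa using hbnd 1 (k + 1) (by simpa using main k) y hy
  have hlim : Tendsto (fun k : ℕ => (2 * M) * (‖y‖ / r) ^ (k + 2)) atTop (𝓝 ((2 * M) * 0)) :=
    ((tendsto_add_atTop_iff_nat 2).2
      (tendsto_pow_atTop_nhds_zero_of_lt_one (by positivity) hlt)).const_mul _
  have := ge_of_tendsto' hlim hle
  rw [mul_zero] at this
  exact sub_eq_zero.1 (norm_eq_zero.1 (le_antisymm this (norm_nonneg _)))

variable {m n : ℕ}

/-! ### Holomorphic self-maps of bounded complete Reinhardt domains -/

/-- The trace of a complete Reinhardt domain on a coordinate axis is a disc, which contains the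
corresponding coordinate projection of the domain. -/
theorem IsBoundedCompleteReinhardt.exists_axis_eq_ball {W : Set (Fin n → ℂ)}
    (hW : IsBoundedCompleteReinhardt W) (i : Fin n) :
    ∃ R > 0, (∀ t : ℂ, t ∈ Metric.ball 0 R ↔ Pi.single i t ∈ W) ∧ ∀ w ∈ W, ‖w i‖ < R := by
  obtain ⟨⟨hWo, hWc⟩, hWb, hWr⟩ := hW
  obtain ⟨M, hMpos, hM⟩ := hWb.exists_pos_norm_le
  set K : Set ℂ := {t | Pi.single i t ∈ W} with hK
  have hKo : IsOpen K := hWo.preimage (continuous_single i)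
  have h0 : (0 : ℂ) ∈ K := by
    obtain ⟨w, hw⟩ := hWc.nonempty
    exact hWr w hw _ (by simp)
  have hKb : BddAbove (Set.image norm K) := by
    refine ⟨M, ?_⟩
    rintro _ ⟨t, ht, rfl⟩
    have := hM _ ht
    rwa [Pi.norm_single] at this
  have hmono : ∀ s ∈ K, ∀ t : ℂ, ‖t‖ ≤ ‖s‖ → t ∈ K := by
    intro s hs t hts
    refine hWr _ hs _ fun j => ?_
    rcases eq_or_ne j i with rfl | hj
    · simpa using hts
    · simp [hj]
  -- Since `K` is open, every point of it can be pushed radially outwards, so the supremum is not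
  -- attained.
  have hlt : ∀ t ∈ K, ‖t‖ < sSup (Set.image norm K) := by
    intro t ht
    obtain ⟨r, hr, hrK⟩ := Metric.isOpen_iff.1 hKo t ht
    have hex : ∃ s ∈ K, ‖t‖ < ‖s‖ := by
      rcases eq_or_ne t 0 with rfl | ht0
      · refine ⟨((r / 2 : ℝ) : ℂ), hrK ?_, ?_⟩
        · rw [mem_ball_zero_iff, Complex.norm_real, Real.norm_of_nonneg (by positivity)]; linarith
        · rw [Complex.norm_real, Real.norm_of_nonneg (by positivity), norm_zero]; positivity
      · have htp : 0 < ‖t‖ := norm_pos_iff.2 ht0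
        refine ⟨((1 + r / (2 * ‖t‖) : ℝ) : ℂ) * t, hrK ?_, ?_⟩
        · have : ((1 + r / (2 * ‖t‖) : ℝ) : ℂ) * t - t = ((r / (2 * ‖t‖) : ℝ) : ℂ) * t := by
            push_cast; ring
          rw [mem_ball_iff_norm, this, norm_mul, Complex.norm_real,
            Real.norm_of_nonneg (by positivity)]
          field_simp
          linarith
        · rw [norm_mul, Complex.norm_real, Real.norm_of_nonneg (by positivity)]
          have : 0 < r / (2 * ‖t‖) * ‖t‖ := by positivity
          linarith
    obtain ⟨s, hs, hts⟩ := hex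
    exact hts.trans_le (le_csSup hKb ⟨s, hs, rfl⟩)
  refine ⟨sSup (Set.image norm K), by simpa using hlt 0 h0, fun t => ⟨fun ht => ?_, fun ht => ?_⟩, ?_⟩
  · rw [mem_ball_zero_iff] at ht
    obtain ⟨_, ⟨s, hs, rfl⟩, hts⟩ := exists_lt_of_lt_csSup ⟨_, mem_image_of_mem _ h0⟩ ht
    exact hmono s hs t hts.le
  · rw [mem_ball_zero_iff]; exact hlt t ht
  · intro w hw
    refine hlt (w i) (hWr w hw _ fun j => ?_)
    rcases eq_or_ne j i with rfl | hj
    · simp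
    · simp [hj]

theorem IsBoundedCompleteReinhardt.zero_mem {W : Set (Fin n → ℂ)}
    (hW : IsBoundedCompleteReinhardt W) : (0 : Fin n → ℂ) ∈ W := by
  obtain ⟨w, hw⟩ := hW.1.2.nonempty
  exact hW.2.2 w hw 0 (by simp)

/-- The diagonal derivatives at the origin of a holomorphic self-map of a bounded complete
Reinhardt domain have modulus at most one. -/
theorem IsBoundedCompleteReinhardt.norm_deriv_le_one {W : Set (Fin n → ℂ)}
    (hW : IsBoundedCompleteReinhardt W) {h : (Fin n → ℂ) → (Fin n → ℂ)}
    (hd : DifferentiableOn ℂ h W) (hm : MapsTo h W W) (i : Fin n) :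
    ‖deriv (fun t : ℂ => h (Pi.single i t) i) 0‖ ≤ 1 := by
  obtain ⟨R, hR, hball, hproj⟩ := hW.exists_axis_eq_ball i
  have hs : Differentiable ℂ (fun t : ℂ => (Pi.single i t : Fin n → ℂ)) :=
    (ContinuousLinearMap.single ℂ (fun _ : Fin n => ℂ) i).differentiable
  have hk : DifferentiableOn ℂ (fun t : ℂ => h (Pi.single i t) i) (Metric.ball 0 R) :=
    differentiableOn_pi.1 (hd.comp hs.differentiableOn fun t ht => (hball t).1 ht) i
  -- The axis and the coordinate projection have the same radius `R`, so Cauchy's estimate gives `R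
  -- / r`; let `r → R`.
  have hev : ∀ᶠ r in 𝓝[<] R, ‖deriv (fun t : ℂ => h (Pi.single i t) i) 0‖ ≤ R / r := by
    filter_upwards [Ioo_mem_nhdsLT hR] with r hr
    refine Complex.norm_deriv_le_of_forall_mem_sphere_norm_le hr.1 (hk.diffContOnCl_ball ?_) ?_
    · exact Metric.closedBall_subset_ball hr.2
    · intro t ht
      refine (hproj _ (hm ((hball t).1 ?_))).le
      rw [mem_sphere_zero_iff_norm] at ht
      rw [mem_ball_zero_iff, ht]; exact hr.2
  have hlim : Tendsto (fun r => R / r) (𝓝[<] R) (𝓝 (R / R)) :=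
    (ContinuousAt.div continuousAt_const continuousAt_id hR.ne').continuousWithinAt
  rw [div_self hR.ne'] at hlim
  exact ge_of_tendsto hlim hev

/-- A holomorphic self-map of a bounded complete Reinhardt domain all of whose diagonal
derivatives at the origin equal one is the identity. -/
theorem IsBoundedCompleteReinhardt.eqOn_id_of_deriv_eq_one {W : Set (Fin n → ℂ)}
    (hW : IsBoundedCompleteReinhardt W) {h : (Fin n → ℂ) → (Fin n → ℂ)}
    (hd : DifferentiableOn ℂ h W) (hm : MapsTo h W W)
    (hone : ∀ i, deriv (fun t : ℂ => h (Pi.single i t) i) 0 = 1) : EqOn h id W := by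
  have h0W := hW.zero_mem
  have hWo := hW.1.1
  have hs : ∀ i, Differentiable ℂ (fun t : ℂ => (Pi.single i t : Fin n → ℂ)) := fun i =>
    (ContinuousLinearMap.single ℂ (fun _ : Fin n => ℂ) i).differentiable
  have hfix : h 0 = 0 := by
    funext i
    obtain ⟨R, hR, hball, hproj⟩ := hW.exists_axis_eq_ball i
    have := eq_zero_of_mapsTo_ball_of_deriv_eq_one (k := fun t : ℂ => h (Pi.single i t) i) hR
      (differentiableOn_pi.1 (hd.comp (hs i).differentiableOn fun t ht => (hball t).1 ht) i)
      (fun t ht => mem_ball_zero_iff.2 (hproj _ (hm ((hball t).1 ht)))) (hone i)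
    simpa using this
  have hdat : DifferentiableAt ℂ h 0 := hd.differentiableAt (hWo.mem_nhds h0W)
  set T := fderiv ℂ h 0 with hT
  have hpow : ∀ k : ℕ, HasFDerivAt h^[k] (T ^ k) 0 := fun k =>
    HasFDerivAt.iterate hdat.hasFDerivAt hfix k
  obtain ⟨r, hr, hrW⟩ := Metric.isOpen_iff.1 hWo 0 h0W
  obtain ⟨M, hMpos, hM⟩ := hW.2.1.exists_pos_norm_le
  have hit_m : ∀ j : ℕ, MapsTo h^[j] W W := fun j => hm.iterate j
  have hit_d : ∀ j : ℕ, DifferentiableOn ℂ h^[j] W := fun j => by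
    induction j with
    | zero => exact differentiableOn_id
    | succ j ih => rw [Function.iterate_succ']; exact hd.comp ih (hit_m j)
  have hbound : ∀ k : ℕ, ‖T ^ k‖ ≤ M / r := by
    intro k
    rw [← (hpow k).fderiv]
    refine Complex.norm_fderiv_le_div_of_mapsTo_ball ((hit_d k).mono hrW) ?_ hr
    intro x hx
    rw [Function.iterate_fixed hfix k, mem_closedBall_zero_iff]
    exact hM _ (hit_m k (hrW hx))
  have hTii : ∀ i, T (Pi.single i 1) i = 1 := by
    intro i
    have h1 : HasDerivAt (fun t : ℂ => (Pi.single i t : Fin n → ℂ)) (Pi.single i 1) 0 := by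
      have := (ContinuousLinearMap.single ℂ (fun _ : Fin n => ℂ) i).hasDerivAt (x := (0 : ℂ))
      simpa using this
    have h2 : HasFDerivAt h T (Pi.single i (0 : ℂ)) := by simpa using hdat.hasFDerivAt
    have h3 := hasDerivAt_pi.1 (h2.comp_hasDerivAt (0 : ℂ) h1) i
    exact h3.deriv.symm.trans (hone i)
  -- The trace involves only the diagonal derivatives; power-boundedness supplies what is needed
  -- about the off-diagonal ones.
  have htr : LinearMap.trace ℂ (Fin n → ℂ) (T : (Fin n → ℂ) →ₗ[ℂ] (Fin n → ℂ)) =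
      Module.finrank ℂ (Fin n → ℂ) := by
    rw [LinearMap.trace_eq_matrix_trace ℂ (Pi.basisFun ℂ (Fin n))]
    simp [Matrix.trace, hTii]
  have hT1 := eq_one_of_norm_pow_le_of_trace_eq T hbound htr
  refine eqOn_of_isPreconnected_of_eventuallyEq hWo hW.1.2.isPreconnected hd differentiableOn_id
    h0W (eventually_eq_id_of_fderiv_eq_one hWo hW.2.1 h0W hd hm hfix ?_)
  have := hdat.hasFDerivAt
  rw [← hT, hT1] at this
  exact this

/-! ### Holomorphic dependence of derivatives, and contact in epsilon form -/

/-- The partial derivative of a holomorphic function of two variables is holomorphic. -/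
theorem differentiableOn_deriv_snd {F : ℂ × ℂ → ℂ} {U : Set (ℂ × ℂ)} (hU : IsOpen U)
    (hF : DifferentiableOn ℂ F U) {S : Set ℂ} (hSU : ∀ z ∈ S, (z, (0 : ℂ)) ∈ U) :
    DifferentiableOn ℂ (fun z => deriv (fun t => F (z, t)) 0) S := by
  intro z₀ hz₀
  refine DifferentiableAt.differentiableWithinAt ?_
  obtain ⟨r, hr, hrU⟩ := Metric.isOpen_iff.1 hU _ (hSU z₀ hz₀)
  obtain ⟨r', hr', hrF⟩ := Metric.continuousAt_iff.1
    (hF.continuousOn.continuousAt (hU.mem_nhds (hSU z₀ hz₀))) 1 one_pos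
  set s := min r r' with hs
  have hspos : 0 < s := lt_min hr hr'
  have hsub : ∀ z ∈ Metric.ball z₀ s, ∀ t ∈ Metric.ball (0 : ℂ) s,
      (z, t) ∈ U ∧ ‖F (z, t) - F (z₀, 0)‖ < 1 := by
    intro z hz t ht
    have h1 : dist (z, t) (z₀, 0) < s := by rw [Prod.dist_eq]; exact max_lt hz ht
    exact ⟨hrU (h1.trans_le (min_le_left _ _)), by
      rw [← dist_eq_norm]; exact hrF (h1.trans_le (min_le_right _ _))⟩
  have hFt : ∀ z ∈ Metric.ball z₀ s,
      DifferentiableOn ℂ (fun t => F (z, t)) (Metric.ball 0 s) := fun z hz =>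
    hF.comp (by fun_prop) fun t ht => (hsub z hz t ht).1
  have hFz : ∀ t ∈ Metric.ball (0 : ℂ) s,
      DifferentiableOn ℂ (fun z => F (z, t)) (Metric.ball z₀ s) := fun t ht =>
    hF.comp (by fun_prop) fun z hz => (hsub z hz t ht).1
  have h0s : (0 : ℂ) ∈ Metric.ball (0 : ℂ) s := by simpa using hspos
  have hder : ∀ z ∈ Metric.ball z₀ s, HasDerivAt (fun t => F (z, t))
      (deriv (fun t => F (z, t)) 0) 0 := fun z hz =>
    ((hFt z hz).differentiableAt (Metric.isOpen_ball.mem_nhds h0s)).hasDerivAt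
  have hderbd : ∀ z ∈ Metric.ball z₀ s, ‖deriv (fun t => F (z, t)) 0‖ ≤ 2 / s := by
    intro z hz
    refine Complex.norm_deriv_le_div_of_mapsTo_ball (hFt z hz) ?_ hspos
    intro t ht
    rw [mem_closedBall_iff_norm]
    have h1 := (hsub z hz t ht).2
    have h2 := (hsub z hz 0 h0s).2
    have : F (z, t) - F (z, 0) = (F (z, t) - F (z₀, 0)) - (F (z, 0) - F (z₀, 0)) := by ring
    rw [this]
    exact (norm_sub_le _ _).trans (by linarith)
  -- Second order Schwarz estimate, uniform in `z`: on the disc `F (z, t) - F (z, 0)` and its linear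
  -- part are each at most `2`, whence the `4`. It makes the difference quotients converge
  -- uniformly.
  have hquad : ∀ z ∈ Metric.ball z₀ s, ∀ t ∈ Metric.ball (0 : ℂ) s,
      ‖F (z, t) - F (z, 0) - t * deriv (fun t => F (z, t)) 0‖ ≤ 4 * (‖t‖ / s) ^ 2 := by
    intro z hz t ht
    set a := deriv (fun t => F (z, t)) 0 with ha
    have := Complex.dist_le_mul_div_pow_of_mapsTo_ball_of_isLittleO
      (f := fun t => F (z, t) - F (z, 0) - t * a) (c := (0 : ℂ)) (z := t) (R₁ := s) (R₂ := 4)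
      (n := 1) (((hFt z hz).sub_const _).sub (by fun_prop)) ?_ ?_ ht
    · simpa using this
    · intro x hx
      have h1 := (hsub z hz x hx).2
      have h2 := (hsub z hz 0 h0s).2
      have e : F (z, x) - F (z, 0) = (F (z, x) - F (z₀, 0)) - (F (z, 0) - F (z₀, 0)) := by ring
      have h3 : ‖x * a‖ ≤ 2 := by
        rw [norm_mul]
        have hx' : ‖x‖ < s := by simpa using hx
        calc ‖x‖ * ‖a‖ ≤ s * (2 / s) := by gcongr; exact hderbd z hz
          _ = 2 := by field_simp
      simp only [sub_self, zero_mul, mem_closedBall_zero_iff]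
      refine (norm_sub_le _ _).trans ?_
      rw [e]
      have := norm_sub_le (F (z, x) - F (z₀, 0)) (F (z, 0) - F (z₀, 0))
      linarith
    · have := (hder z hz).isLittleO
      simpa [mul_comm] using this.norm_right
  have hlim : TendstoLocallyUniformlyOn (fun (t : ℂ) z => t⁻¹ * (F (z, t) - F (z, 0)))
      (fun z => deriv (fun t => F (z, t)) 0) (𝓝[≠] 0) (Metric.ball z₀ s) := by
    apply TendstoUniformlyOn.tendstoLocallyUniformlyOn
    rw [Metric.tendstoUniformlyOn_iff]
    intro ε hε
    have hev : ∀ᶠ t : ℂ in 𝓝[≠] 0, ‖t‖ < min s (ε * s ^ 2 / 4) := by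
      have : Metric.ball (0 : ℂ) (min s (ε * s ^ 2 / 4)) ∈ 𝓝 (0 : ℂ) :=
        Metric.ball_mem_nhds _ (lt_min hspos (by positivity))
      filter_upwards [mem_nhdsWithin_of_mem_nhds this] with t ht
      simpa using ht
    filter_upwards [hev, self_mem_nhdsWithin] with t ht ht0 z hz
    have htp : 0 < ‖t‖ := norm_pos_iff.2 ht0
    have hq := hquad z hz t (by simpa using ht.trans_le (min_le_left _ _))
    have e : t⁻¹ * (F (z, t) - F (z, 0)) - deriv (fun t => F (z, t)) 0 =
        t⁻¹ * (F (z, t) - F (z, 0) - t * deriv (fun t => F (z, t)) 0) := by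
      have : t ≠ 0 := ht0
      field_simp
    rw [dist_comm, dist_eq_norm, e, norm_mul, norm_inv]
    calc ‖t‖⁻¹ * _ ≤ ‖t‖⁻¹ * (4 * (‖t‖ / s) ^ 2) := by gcongr
      _ = 4 / s ^ 2 * ‖t‖ := by field_simp
      _ < 4 / s ^ 2 * (ε * s ^ 2 / 4) := by gcongr; exact ht.trans_le (min_le_right _ _)
      _ = ε := by field_simp
  have hd : ∀ᶠ t : ℂ in 𝓝[≠] 0,
      DifferentiableOn ℂ (fun z => t⁻¹ * (F (z, t) - F (z, 0))) (Metric.ball z₀ s) := by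
    filter_upwards [mem_nhdsWithin_of_mem_nhds (Metric.ball_mem_nhds (0 : ℂ) hspos)] with t ht
    exact ((hFz t ht).sub (hFz 0 h0s)).const_mul _
  exact (hlim.differentiableOn hd Metric.isOpen_ball).differentiableAt
    (Metric.ball_mem_nhds _ hspos)

theorem eqIdAddLittleONontangential_iff {E : Type*} [NormedAddCommGroup E] {Ω : Set E} {q : E}
    {k : ℕ} {f : E → E} :
    EqIdAddLittleONontangential Ω q k f ↔ ∀ κ : ℝ, ∀ ε > 0, ∃ ρ > 0,
      ∀ x ∈ approachRegion Ω q κ, ‖x - q‖ < ρ → ‖f x - x‖ ≤ ε * ‖x - q‖ ^ k := by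
  refine forall_congr' fun κ => ?_
  rw [isLittleO_iff]
  refine forall₂_congr fun ε hε => ?_
  rw [eventually_nhdsWithin_iff, Metric.eventually_nhds_iff]
  simp only [dist_eq_norm, norm_pow, norm_norm]
  exact ⟨fun ⟨ρ, hρ, hb⟩ => ⟨ρ, hρ, fun x hx hxr => hb hxr hx⟩,
    fun ⟨ρ, hρ, hb⟩ => ⟨ρ, hρ, fun x hxr hx => hb x hx hxr⟩⟩

/-! ### The cone, approach regions and the base component -/

/-- The cone condition and completeness of the fibers provide, over each point `z₀` of `D`, a
Reinhardt neighbourhood of the zero section bounded by a linear graph. -/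
theorem SatisfiesConeCondition.exists_linearMap {D : Set (Fin m → ℂ)} {p : Fin m → ℂ}
    {Ω : Set ((Fin m → ℂ) × (Fin n → ℂ))} (hcone : SatisfiesConeCondition D p Ω)
    (hΩ : IsReinhardtFibered D Ω) {z₀ : Fin m → ℂ} (hz₀ : z₀ ∈ D) :
    ∃ A : (Fin m → ℂ) →L[ℂ] (Fin n → ℂ), ∃ d : ℝ, 0 < d ∧ (∀ i, A (z₀ - p) i = d) ∧
      ∀ ζ ∈ D, ∀ w : Fin n → ℂ, (∀ i, ‖w i‖ ≤ ‖A (ζ - p) i‖) → (ζ, w) ∈ Ω := by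
  obtain ⟨δ, hδ, -, -, A, hA, hsub⟩ := hcone
  have hd := hδ z₀ hz₀
  -- All coordinates are nonzero, so the fattened graph contains a full neighbourhood of `(z₀, 0)`;
  -- their equality lets one direction shift all coordinates of `A` alike.
  set w₀ : Fin n → ℂ := fun _ => ((δ z₀ / 2 : ℝ) : ℂ) with hw₀
  have hw : w₀ ∈ polydisc n (δ z₀) := fun i => by
    simp only [hw₀]
    rw [Complex.norm_real, Real.norm_of_nonneg (by positivity)]
    linarith
  refine ⟨LinearMap.toContinuousLinearMap (A z₀ w₀), δ z₀ / 2, by positivity, fun i => ?_,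
    fun ζ hζ w hle => ?_⟩
  · rw [LinearMap.coe_toContinuousLinearMap', hA z₀ hz₀ w₀ hw]
  · have hmem : (ζ, A z₀ w₀ (ζ - p)) ∈ Ω := hsub ⟨z₀, hz₀, w₀, hw, hζ, rfl⟩
    exact (hΩ.2.2 ζ hζ).2.2 _ hmem w hle

/-- Points over an approach region of `D` that lie well inside a linear cone form part of an
approach region of `Ω`. -/
theorem exists_aperture {D : Set (Fin m → ℂ)} {p : Fin m → ℂ}
    {Ω : Set ((Fin m → ℂ) × (Fin n → ℂ))} (hp : p ∉ D) (hpΩ : (p, (0 : Fin n → ℂ)) ∉ Ω)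
    (A : (Fin m → ℂ) →L[ℂ] (Fin n → ℂ))
    (hA : ∀ ζ ∈ D, ∀ w : Fin n → ℂ, (∀ i, ‖w i‖ ≤ ‖A (ζ - p) i‖) → (ζ, w) ∈ Ω)
    {κ β : ℝ} (hκ : 0 < κ) (hβ : 0 < β) :
    ∃ κ' : ℝ, ∀ ζ ∈ approachRegion D p κ, ∀ w : Fin n → ℂ,
      (∀ i, β * ‖ζ - p‖ ≤ ‖A (ζ - p) i‖) → (∀ i, ‖w i‖ ≤ 1 / 2 * ‖A (ζ - p) i‖) →
      (ζ, w) ∈ approachRegion Ω (p, 0) κ' ∧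
        ‖(ζ, w) - (p, (0 : Fin n → ℂ))‖ ≤ (1 + ‖A‖) * ‖ζ - p‖ := by
  -- The ball of radius `η * r` about `(ζ, w)` stays in `Ω`: `1 / κ` keeps the base point in `D`,
  -- and the second term uses up the slack `1 / 2 * ‖A (ζ - p) i‖ ≥ β * r / 2`.
  set η := min (1 / κ) (β / (2 * (‖A‖ + 1))) with hη
  have hηpos : 0 < η := lt_min (by positivity) (by positivity)
  refine ⟨(1 + ‖A‖) / η, ?_⟩
  rintro ζ ⟨hζD, hζ⟩ w hβA hw
  set r := ‖ζ - p‖ with hr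
  have hrpos : 0 < r := norm_pos_iff.2 (sub_ne_zero.2 fun h => hp (h ▸ hζD))
  have hAi : ∀ v : Fin m → ℂ, ∀ i, ‖A v i‖ ≤ ‖A‖ * ‖v‖ := fun v i =>
    (norm_le_pi_norm _ i).trans (A.le_opNorm v)
  have hbound : ‖(ζ, w) - (p, (0 : Fin n → ℂ))‖ ≤ (1 + ‖A‖) * r := by
    rw [Prod.mk_sub_mk, sub_zero, Prod.norm_mk]
    have hA0 := norm_nonneg A
    refine max_le (by nlinarith) ?_
    refine (pi_norm_le_iff_of_nonneg (by positivity)).2 fun i => ?_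
    have h1 := hw i
    have h2 := hAi (ζ - p) i
    rw [← hr] at h2
    have h3 := norm_nonneg (A (ζ - p) i)
    nlinarith
  have hball : Metric.ball (ζ, w) (η * r) ⊆ Ω := by
    rintro ⟨ζ', w'⟩ hx
    rw [Metric.mem_ball, Prod.dist_eq, max_lt_iff] at hx
    obtain ⟨h1, h2⟩ := hx
    simp only at h1 h2
    have hζ' : ζ' ∈ D := by
      refine Metric.ball_infDist_compl_subset (x := ζ) (s := D) ?_
      rw [Metric.mem_ball]
      refine h1.trans_le ?_
      calc η * r ≤ 1 / κ * r := by gcongr; exact min_le_left _ _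
        _ ≤ 1 / κ * (κ * Metric.infDist ζ Dᶜ) := by gcongr
        _ = Metric.infDist ζ Dᶜ := by field_simp
    refine hA ζ' hζ' w' fun i => ?_
    have h3 : ‖w' i‖ ≤ ‖w i‖ + η * r := by
      have := (dist_le_pi_dist w' w i).trans h2.le
      rw [dist_eq_norm] at this
      linarith [norm_le_insert' (w' i) (w i)]
    have h4 : ‖A (ζ - p) i‖ ≤ ‖A (ζ' - p) i‖ + ‖A‖ * (η * r) := by
      have e : A (ζ - p) i = A (ζ' - p) i - A (ζ' - ζ) i := by
        rw [← Pi.sub_apply, ← map_sub, show ζ' - p - (ζ' - ζ) = ζ - p by abel]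
      rw [e]
      refine (norm_sub_le _ _).trans ?_
      gcongr
      refine (hAi _ i).trans ?_
      gcongr
      rw [← dist_eq_norm]; exact h1.le
    have h5 : (‖A‖ + 1) * η ≤ β / 2 := by
      calc (‖A‖ + 1) * η ≤ (‖A‖ + 1) * (β / (2 * (‖A‖ + 1))) := by
            gcongr; exact min_le_right _ _
        _ = β / 2 := by field_simp
    have h6 := hw i
    have h7 := hβA i
    have h8 : (‖A‖ + 1) * η * r ≤ β / 2 * r := by gcongr
    nlinarith
  have hmem : (ζ, w) ∈ Ω := hball (Metric.mem_ball_self (by positivity))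
  have hinf : η * r ≤ Metric.infDist (ζ, w) Ωᶜ := by
    refine (Metric.le_infDist ⟨_, hpΩ⟩).2 fun y hy => ?_
    by_contra hlt
    push Not at hlt
    exact hy (hball (by rwa [Metric.mem_ball']))
  refine ⟨⟨hmem, hbound.trans ?_⟩, hbound⟩
  calc (1 + ‖A‖) * r = (1 + ‖A‖) / η * (η * r) := by field_simp
    _ ≤ _ := by gcongr

/-- Among boundedly many radii one stays away from any `n` given real numbers. -/
theorem exists_radius_separated (n : ℕ) {b₀ : ℝ} (hb₀ : 0 < b₀) :
    ∃ β > 0, ∀ x : Fin n → ℝ, ∃ b, 0 < b ∧ b ≤ b₀ ∧ ∀ i, β ≤ |x i - b| := by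
  -- Half the spacing of `n + 1` equidistant candidates in `(0, b₀]`: each `x i` is this close to at
  -- most one of them, so one candidate is left.
  refine ⟨b₀ / (2 * (n + 1)), by positivity, fun x => ?_⟩
  by_contra hcon
  push Not at hcon
  have hk : ∀ k : Fin (n + 1), ∃ i : Fin n,
      |x i - ((k : ℕ) + 1) * (b₀ / (n + 1))| < b₀ / (2 * (n + 1)) := by
    intro k
    refine hcon _ (by positivity) ?_
    have : ((k : ℕ) : ℝ) + 1 ≤ n + 1 := by
      have := k.2; norm_cast
    calc (((k : ℕ) : ℝ) + 1) * (b₀ / (n + 1)) ≤ (n + 1) * (b₀ / (n + 1)) := by gcongr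
      _ = b₀ := by field_simp
  choose φ hφ using hk
  obtain ⟨j, k, hne, heq⟩ := Fintype.exists_ne_map_eq_of_card_lt φ (by simp)
  have h1 := hφ j
  have h2 := hφ k
  rw [heq] at h1
  have h3 : |(((j : ℕ) : ℝ) - (k : ℕ)) * (b₀ / (n + 1))| < b₀ / (n + 1) := by
    have e : (((j : ℕ) : ℝ) - (k : ℕ)) * (b₀ / (n + 1)) =
        (x (φ k) - ((k : ℕ) + 1) * (b₀ / (n + 1))) -
          (x (φ k) - ((j : ℕ) + 1) * (b₀ / (n + 1))) := by ring
    have e2 : b₀ / (n + 1 : ℝ) = b₀ / (2 * (n + 1)) + b₀ / (2 * (n + 1)) := by field_simp; ring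
    rw [e]
    refine (abs_sub _ _).trans_lt ?_
    linarith
  have hs : 0 < b₀ / (n + 1 : ℝ) := by positivity
  rw [abs_mul, abs_of_pos hs] at h3
  have h4 : |(((j : ℕ) : ℝ) - (k : ℕ))| < 1 := by
    by_contra h
    push Not at h
    nlinarith
  have h5 : |((j : ℕ) : ℤ) - ((k : ℕ) : ℤ)| < 1 := by exact_mod_cast h4
  apply hne
  apply Fin.ext
  have := Int.abs_lt_one_iff.1 h5
  omega

/-- Restricted to a linear graph inside the cone, the base component of `f` agrees with the
identity to third order non-tangentially: this holds where the graph stays away from the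
coordinate hyperplanes, and extends to the whole approach region by the maximum principle. -/
theorem eqIdAddLittleONontangential_graph {D : Set (Fin m → ℂ)}
    {p : Fin m → ℂ} (hp : p ∉ D) {Ω : Set ((Fin m → ℂ) × (Fin n → ℂ))}
    (hpΩ : (p, (0 : Fin n → ℂ)) ∉ Ω)
    {f : (Fin m → ℂ) × (Fin n → ℂ) → (Fin m → ℂ) × (Fin n → ℂ)}
    (hf : DifferentiableOn ℂ f Ω) (hlim : EqIdAddLittleONontangential Ω (p, 0) 3 f)
    (A : (Fin m → ℂ) →L[ℂ] (Fin n → ℂ))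
    (hA : ∀ ζ ∈ D, ∀ w : Fin n → ℂ, (∀ i, ‖w i‖ ≤ ‖A (ζ - p) i‖) → (ζ, w) ∈ Ω)
    {z₀ : Fin m → ℂ} (hz₀ : z₀ ∈ D) {d : ℝ} (hd : 0 < d) (hAd : ∀ i, A (z₀ - p) i = d)
    {s : Fin n → ℂ} (hs : ∀ i, ‖s i‖ ≤ 1 / 2) :
    DifferentiableOn ℂ (fun ζ => (f (ζ, s * A (ζ - p))).1) D ∧
      EqIdAddLittleONontangential D p 3 (fun ζ => (f (ζ, s * A (ζ - p))).1) := by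
  set g : (Fin m → ℂ) → (Fin m → ℂ) := fun ζ => (f (ζ, s * A (ζ - p))).1 with hg
  have hhalf : ∀ ζ i, ‖(s * A (ζ - p)) i‖ ≤ 1 / 2 * ‖A (ζ - p) i‖ := fun ζ i => by
    rw [Pi.mul_apply, norm_mul]; gcongr; exact hs i
  have hgd : DifferentiableOn ℂ g D := by
    have h1 : Differentiable ℂ (fun ζ : Fin m → ℂ => (ζ, s * A (ζ - p))) := by fun_prop
    refine (hf.comp h1.differentiableOn fun ζ hζ => hA ζ hζ _ fun i => ?_).fst
    have := hhalf ζ i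
    have := norm_nonneg (A (ζ - p) i)
    linarith
  refine ⟨hgd, eqIdAddLittleONontangential_iff.2 fun κ ε hε => ?_⟩
  rcases le_or_gt κ 0 with hκ | hκ
  · refine ⟨1, one_pos, fun ζ hζ _ => ?_⟩
    exfalso
    have h1 : 0 < ‖ζ - p‖ := norm_pos_iff.2 (sub_ne_zero.2 fun h => hp (h ▸ hζ.1))
    have h2 := hζ.2
    have h3 : 0 ≤ Metric.infDist ζ Dᶜ := Metric.infDist_nonneg
    nlinarith
  -- As `A u` has all coordinates `d`, moving from `ζ` to `ζ + t • u` adds `t * d` to every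
  -- coordinate of `A (ζ - p)`. On a circle `‖t‖ = b * r` with `b` separated from all `‖A (ζ - p) i‖
  -- / (r * d)`, no coordinate comes close to zero.
  set u := z₀ - p with hu
  have hupos : 0 < ‖u‖ := norm_pos_iff.2 (sub_ne_zero.2 fun h => hp (h ▸ hz₀))
  -- On the disc at least half of the bound `r / κ` for the distance to the complement survives, and
  -- the distance to `p` is at most `3 / 2 * r`; together they give aperture `3 * κ`.
  set b₀ := min (1 / (2 * κ)) (1 / 2) / ‖u‖ with hb₀
  have hb₀pos : 0 < b₀ := by positivity
  obtain ⟨β, hβ, hsep⟩ := exists_radius_separated n hb₀pos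
  obtain ⟨κ', hκ'⟩ := exists_aperture hp hpΩ A hA (show 0 < 3 * κ by positivity)
    (show 0 < β * d * (2 / 3) by positivity)
  set C := (1 + ‖A‖) * (3 / 2) with hC
  have hCpos : 0 < C := by positivity
  obtain ⟨ρ, hρ, hfρ⟩ := eqIdAddLittleONontangential_iff.1 hlim κ' (ε / C ^ 3) (by positivity)
  refine ⟨ρ / C, by positivity, ?_⟩
  rintro ζ ⟨hζD, hζ⟩ hζρ
  set r := ‖ζ - p‖ with hr
  have hrpos : 0 < r := norm_pos_iff.2 (sub_ne_zero.2 fun h => hp (h ▸ hζD))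
  obtain ⟨b, hb, hbb₀, hbsep⟩ := hsep fun i => ‖A (ζ - p) i‖ / (r * d)
  have hbu : b * ‖u‖ ≤ min (1 / (2 * κ)) (1 / 2) := by
    rw [hb₀, le_div_iff₀ hupos] at hbb₀; exact hbb₀
  have hbu1 : b * ‖u‖ ≤ 1 / (2 * κ) := hbu.trans (min_le_left _ _)
  have hbu2 : b * ‖u‖ ≤ 1 / 2 := hbu.trans (min_le_right _ _)
  have hinf : r / κ ≤ Metric.infDist ζ Dᶜ := by
    rw [div_le_iff₀ hκ, mul_comm]; exact hζ
  set l : ℂ → (Fin m → ℂ) := fun t => ζ + t • u with hl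
  have hld : Differentiable ℂ l := by fun_prop
  have hdist : ∀ t ∈ Metric.closedBall (0 : ℂ) (b * r), ‖l t - ζ‖ ≤ b * ‖u‖ * r := by
    intro t ht
    rw [mem_closedBall_zero_iff] at ht
    simp only [hl, add_sub_cancel_left, norm_smul]
    calc ‖t‖ * ‖u‖ ≤ b * r * ‖u‖ := by gcongr
      _ = _ := by ring
  have hlD : ∀ t ∈ Metric.closedBall (0 : ℂ) (b * r), l t ∈ D := by
    intro t ht
    refine Metric.ball_infDist_compl_subset (x := ζ) (s := D) ?_
    rw [mem_ball_iff_norm]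
    refine (hdist t ht).trans_lt (lt_of_lt_of_le ?_ hinf)
    calc b * ‖u‖ * r ≤ 1 / (2 * κ) * r := by gcongr
      _ = (r / κ) / 2 := by field_simp
      _ < r / κ := half_lt_self (by positivity)
  have hsphere : ∀ t ∈ Metric.sphere (0 : ℂ) (b * r), ‖g (l t) - l t‖ ≤ ε * r ^ 3 := by
    intro t ht
    have htc := Metric.sphere_subset_closedBall ht
    have hdt := hdist t htc
    rw [mem_sphere_zero_iff_norm] at ht
    have hup : ‖l t - p‖ ≤ 3 / 2 * r := by
      have e : l t - p = (l t - ζ) + (ζ - p) := by abel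
      rw [e]
      refine (norm_add_le _ _).trans ?_
      rw [← hr]
      nlinarith
    have hreg : l t ∈ approachRegion D p (3 * κ) := by
      refine ⟨hlD t htc, hup.trans ?_⟩
      have h1 : Metric.infDist ζ Dᶜ ≤ Metric.infDist (l t) Dᶜ + dist ζ (l t) :=
        Metric.infDist_le_infDist_add_dist
      rw [dist_comm, dist_eq_norm] at h1
      have h2 : b * ‖u‖ * r ≤ 1 / (2 * κ) * r := by gcongr
      have h3 : r / κ - 1 / (2 * κ) * r ≤ Metric.infDist (l t) Dᶜ := by linarith
      calc 3 / 2 * r = 3 * κ * (r / κ - 1 / (2 * κ) * r) := by field_simp; ring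
        _ ≤ _ := by gcongr
    have hlow : ∀ i, β * d * (2 / 3) * ‖l t - p‖ ≤ ‖A (l t - p) i‖ := by
      intro i
      have e : A (l t - p) i = A (ζ - p) i + t * d := by
        have : l t - p = (ζ - p) + t • u := by simp only [hl]; abel
        rw [this, map_add, map_smul, Pi.add_apply, Pi.smul_apply, hAd i, smul_eq_mul]
      have h1 := hbsep i
      have h2 : |‖A (ζ - p) i‖ - b * r * d| = |‖A (ζ - p) i‖ / (r * d) - b| * (r * d) := by
        rw [← abs_of_pos (show 0 < r * d by positivity), ← abs_mul,
          abs_of_pos (show 0 < r * d by positivity)]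
        congr 1
        field_simp
      have h3 : |‖A (ζ - p) i‖ - b * r * d| ≤ ‖A (ζ - p) i + t * d‖ := by
        have h := abs_norm_sub_norm_le (A (ζ - p) i) (-(t * d))
        rw [sub_neg_eq_add, norm_neg, norm_mul, ht, Complex.norm_real,
          Real.norm_of_nonneg hd.le] at h
        exact h
      rw [e]
      refine le_trans ?_ h3
      rw [h2]
      calc β * d * (2 / 3) * ‖l t - p‖ ≤ β * d * (2 / 3) * (3 / 2 * r) := by gcongr
        _ = β * (r * d) := by ring
        _ ≤ _ := by gcongr
    obtain ⟨hmem, hnorm⟩ := hκ' (l t) hreg (s * A (l t - p)) hlow (hhalf (l t))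
    have hnorm' : ‖(l t, s * A (l t - p)) - (p, (0 : Fin n → ℂ))‖ ≤ C * r := by
      refine hnorm.trans ?_
      rw [hC, mul_assoc]
      gcongr
    have hlt : ‖(l t, s * A (l t - p)) - (p, (0 : Fin n → ℂ))‖ < ρ := by
      refine hnorm'.trans_lt ?_
      rw [lt_div_iff₀ hCpos] at hζρ
      linarith
    have hfin := hfρ _ hmem hlt
    have h1 : ‖g (l t) - l t‖ ≤ ‖f (l t, s * A (l t - p)) - (l t, s * A (l t - p))‖ :=
      norm_fst_le (f (l t, s * A (l t - p)) - (l t, s * A (l t - p)))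
    refine h1.trans (hfin.trans ?_)
    calc _ ≤ ε / C ^ 3 * (C * r) ^ 3 := by gcongr
      _ = ε * r ^ 3 := by field_simp
  -- The centre `t = 0` is `ζ` itself, where coordinates of `A (ζ - p)` may vanish.
  have hmax := Complex.norm_le_of_forall_mem_frontier_norm_le (f := fun t => g (l t) - l t)
    (U := Metric.ball (0 : ℂ) (b * r)) (z := 0) Metric.isBounded_ball
    (DifferentiableOn.diffContOnCl_ball (U := l ⁻¹' D)
      ((hgd.comp hld.differentiableOn fun t ht => ht).sub hld.differentiableOn) hlD)
    (fun t ht => hsphere t (Metric.frontier_ball_subset_sphere ht))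
    (subset_closure (Metric.mem_ball_self (by positivity)))
  simpa [hl] using hmax

/-- The base component of `f` is the projection to the base. -/
theorem fst_eq_of_nontangentialRigidityAt {D : Set (Fin m → ℂ)} (hD : IsDomainSet D)
    {p : Fin m → ℂ} (hp : p ∉ D) (hrigid : NontangentialRigidityAt D p)
    {Ω : Set ((Fin m → ℂ) × (Fin n → ℂ))} (hΩ : IsReinhardtFibered D Ω)
    (hcone : SatisfiesConeCondition D p Ω)
    {f : (Fin m → ℂ) × (Fin n → ℂ) → (Fin m → ℂ) × (Fin n → ℂ)}
    (hf : DifferentiableOn ℂ f Ω) (hmaps : MapsTo f Ω Ω)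
    (hlim : EqIdAddLittleONontangential Ω (p, 0) 3 f) : ∀ x ∈ Ω, (f x).1 = x.1 := by
  have hpΩ : (p, (0 : Fin n → ℂ)) ∉ Ω := fun h => hp (hΩ.2.1 _ h)
  obtain ⟨z₀, hz₀⟩ := hD.2.nonempty
  obtain ⟨A, d, hd, hAd, hA⟩ := hcone.exists_linearMap hΩ hz₀
  have hrig : ∀ ζ ∈ D, ∀ w : Fin n → ℂ, (∀ i, A (ζ - p) i ≠ 0) →
      (∀ i, ‖w i‖ ≤ 1 / 2 * ‖A (ζ - p) i‖) → (f (ζ, w)).1 = ζ := by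
    intro ζ hζ w hne hw
    -- The scaling for which the graph of `s * A (· - p)` passes through `(ζ, w)`.
    set s : Fin n → ℂ := fun i => w i / A (ζ - p) i with hs
    have hs' : ∀ i, ‖s i‖ ≤ 1 / 2 := fun i => by
      rw [hs, norm_div, div_le_iff₀ (norm_pos_iff.2 (hne i))]; exact hw i
    obtain ⟨h1, h2⟩ := eqIdAddLittleONontangential_graph hp hpΩ hf hlim A hA hz₀ hd hAd hs'
    have h3 := hrigid _ h1 (fun x hx => hΩ.2.1 _ (hmaps (hA x hx _ fun i => ?_))) h2 ζ hζ
    · have e : s * A (ζ - p) = w := by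
        funext i; exact div_mul_cancel₀ _ (hne i)
      rwa [e] at h3
    · rw [Pi.mul_apply, norm_mul]
      have := hs' i
      have := norm_nonneg (A (x - p) i)
      nlinarith
  have h0 : (z₀, (0 : Fin n → ℂ)) ∈ Ω := hA z₀ hz₀ 0 (by simp)
  refine eqOn_of_isPreconnected_of_eventuallyEq (f := fun x => (f x).1) (g := fun x => x.1)
    hΩ.1.1 hΩ.1.2.isPreconnected hf.fst differentiableOn_fst h0 ?_
  have e1 : ∀ᶠ x : (Fin m → ℂ) × (Fin n → ℂ) in 𝓝 (z₀, 0), x.1 ∈ D :=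
    continuousAt_fst.eventually (hD.1.mem_nhds hz₀)
  have e2 : ∀ᶠ x : (Fin m → ℂ) × (Fin n → ℂ) in 𝓝 (z₀, 0),
      ∀ i, ‖x.2 i‖ < 1 / 2 * ‖A (x.1 - p) i‖ := by
    rw [eventually_all]
    intro i
    have hc1 : Continuous fun x : (Fin m → ℂ) × (Fin n → ℂ) => ‖x.2 i‖ := by fun_prop
    have hc2 : Continuous fun x : (Fin m → ℂ) × (Fin n → ℂ) => 1 / 2 * ‖A (x.1 - p) i‖ := by
      fun_prop
    refine (hc1.tendsto _).eventually_lt (hc2.tendsto _) ?_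
    simp only [Pi.zero_apply, norm_zero, hAd i, Complex.norm_real, Real.norm_of_nonneg hd.le]
    positivity
  filter_upwards [e1, e2] with x hx1 hx2
  refine hrig x.1 hx1 x.2 (fun i h => ?_) fun i => (hx2 i).le
  have := hx2 i
  rw [h, norm_zero, mul_zero] at this
  exact absurd this (norm_nonneg _).not_gt

/-! ### Sectors at the boundary point and the fiber component -/

/-- At a `C^1` boundary point, `D` contains, for all directions close to an inner normal, the
truncated right-angled complex sectors in these directions. -/
theorem HasC1BoundaryNear.exists_sector {D : Set (Fin m → ℂ)} {p : Fin m → ℂ}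
    (hp : p ∈ closure D) (hC1 : HasC1BoundaryNear D p) :
    ∃ (ν₀ : Fin m → ℂ) (ε t₁ : ℝ), 0 < ε ∧ 0 < t₁ ∧ ∀ ν : Fin m → ℂ, ‖ν - ν₀‖ < ε →
      ∀ σ : ℂ, |σ.im| < σ.re → ‖σ‖ < t₁ → p + σ • ν ∈ D := by
  obtain ⟨U, hU, hpU, ρ, hρ, hne, hDU⟩ := hC1
  have hdiff : DifferentiableAt ℝ ρ p :=
    (hρ.contDiffAt (hU.mem_nhds hpU)).differentiableAt one_ne_zero
  have hρp : ρ p ≤ 0 := by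
    by_contra hlt
    push Not at hlt
    have h1 : ∀ᶠ x in 𝓝 p, 0 < ρ x ∧ x ∈ U :=
      (hdiff.continuousAt.eventually (lt_mem_nhds hlt)).and (hU.mem_nhds hpU)
    obtain ⟨x, hxD, hx1, hx2⟩ := ((mem_closure_iff_frequently.1 hp).and_eventually h1).exists
    have : x ∈ D ∩ U := ⟨hxD, hx2⟩
    rw [hDU] at this
    exact lt_asymm hx1 this.2
  set L := fderiv ℝ ρ p with hL
  obtain ⟨v, hv⟩ : ∃ v, L v ≠ 0 := by
    by_contra h
    push Not at h
    exact hne p hpU (ContinuousLinearMap.ext h)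
  have hLc : ∀ (c : ℂ) (v : Fin m → ℂ), L (c • v) = c.re * L v + c.im * L (Complex.I • v) := by
    intro c v
    have : c • v = c.re • v + c.im • (Complex.I • v) := by
      funext j
      simp only [Pi.smul_apply, Pi.add_apply, smul_eq_mul, Complex.real_smul]
      nth_rw 1 [← Complex.re_add_im c]
      ring
    rw [this, map_add, map_smul, map_smul, smul_eq_mul, smul_eq_mul]
  -- Chosen so that `L (σ • v) = Re (σ * c)`; rescaling `v` by `-c⁻¹` then gives `L (σ • ν₀) = -Re
  -- σ`.
  set c : ℂ := ⟨L v, -L (Complex.I • v)⟩ with hc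
  have hc0 : c ≠ 0 := fun h => hv (congrArg Complex.re h)
  set ν₀ : Fin m → ℂ := (-c⁻¹) • v with hν₀
  have hLν : ∀ σ : ℂ, L (σ • ν₀) = -σ.re := by
    intro σ
    rw [hν₀, smul_smul, hLc]
    have h1 : ((σ * -c⁻¹) * c).re = -σ.re := by
      rw [mul_assoc, neg_mul, inv_mul_cancel₀ hc0]; simp
    have hcre : c.re = L v := rfl
    have hcim : c.im = -L (Complex.I • v) := rfl
    rw [← h1, Complex.mul_re (σ * -c⁻¹) c, hcre, hcim]
    ring
  -- Changing the direction and linearizing `ρ` cost `‖σ‖ / 8` each; since `‖σ‖ ≤ 2 * Re σ` in the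
  -- sector, the total stays below `Re σ`.
  set ε : ℝ := 1 / (8 * (‖L‖ + 1)) with hε
  have hεpos : 0 < ε := by positivity
  set η : ℝ := 1 / (8 * (‖ν₀‖ + ε)) with hη
  have hηpos : 0 < η := by positivity
  have hlo := hdiff.hasFDerivAt.isLittleO.bound hηpos
  obtain ⟨s, hs, hball⟩ := Metric.eventually_nhds_iff.1 (hlo.and (hU.mem_nhds hpU))
  refine ⟨ν₀, ε, s / (‖ν₀‖ + ε), hεpos, by positivity, fun ν hν σ hσ hσs => ?_⟩
  have hσpos : 0 < ‖σ‖ := norm_pos_iff.2 fun h => by simp [h] at hσ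
  have hνn : ‖ν‖ ≤ ‖ν₀‖ + ε := by linarith [norm_le_insert' ν ν₀]
  have hn : ‖σ • ν‖ ≤ ‖σ‖ * (‖ν₀‖ + ε) := by rw [norm_smul]; gcongr
  obtain ⟨h1, h2⟩ := hball (y := p + σ • ν) (by
    rw [dist_eq_norm, add_sub_cancel_left]
    rw [lt_div_iff₀ (by positivity)] at hσs
    linarith)
  rw [add_sub_cancel_left, Real.norm_eq_abs] at h1
  have h3 : L (σ • ν) ≤ -σ.re + ‖σ‖ / 8 := by
    have e : σ • ν = σ • ν₀ + σ • (ν - ν₀) := by rw [← smul_add]; congr 1; abel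
    rw [e, map_add, hLν]
    have h4 : L (σ • (ν - ν₀)) ≤ ‖L‖ * (‖σ‖ * ε) := by
      refine (le_abs_self _).trans ((L.le_opNorm _).trans ?_)
      rw [norm_smul]
      gcongr
    have h5 : ‖L‖ * (‖σ‖ * ε) ≤ ‖σ‖ / 8 := by
      calc ‖L‖ * (‖σ‖ * ε) ≤ (‖L‖ + 1) * (‖σ‖ * ε) := by gcongr; linarith
        _ = ‖σ‖ / 8 := by rw [hε]; field_simp
    linarith
  have h6 : η * ‖σ • ν‖ ≤ ‖σ‖ / 8 := by
    calc η * ‖σ • ν‖ ≤ η * (‖σ‖ * (‖ν₀‖ + ε)) := by gcongr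
      _ = ‖σ‖ / 8 := by rw [hη]; field_simp
  have h7 : ‖σ‖ ≤ 2 * σ.re := by
    refine (Complex.norm_le_abs_re_add_abs_im σ).trans ?_
    rw [abs_of_pos ((abs_nonneg _).trans_lt hσ)]
    linarith
  have hneg : ρ (p + σ • ν) < 0 := by
    have := (le_abs_self _).trans h1
    linarith
  have : p + σ • ν ∈ D ∩ U := by rw [hDU]; exact ⟨h2, hneg⟩
  exact this.1

/-- The square root maps the disc `1 - x`, `‖x‖ < 1`, into a right-angled sector. -/
theorem sqrt_mem_sector {x : ℂ} (hx : x ∈ Metric.ball (0 : ℂ) 1) :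
    1 - x ∈ Complex.slitPlane ∧
      |((1 - x) ^ (1 / 2 : ℂ)).im| < ((1 - x) ^ (1 / 2 : ℂ)).re ∧ ‖(1 - x) ^ (1 / 2 : ℂ)‖ < 2 := by
  rw [mem_ball_zero_iff] at hx
  have hre : 0 < (1 - x).re := by
    have := Complex.re_le_norm x
    simp; linarith
  set y := 1 - x with hy
  have hy0 : y ≠ 0 := fun h => by rw [h] at hre; simp at hre
  set q := y ^ (1 / 2 : ℂ) with hq
  have hsq : q ^ 2 = y := by
    rw [hq, ← Complex.cpow_mul_nat]; simp
  have hqre : 0 ≤ q.re := by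
    rw [hq, Complex.cpow_def_of_ne_zero hy0, Complex.exp_re]
    have him : (Complex.log y * (1 / 2)).im = y.arg / 2 := by
      simp [Complex.log_im]; ring
    rw [him]
    refine mul_nonneg (Real.exp_pos _).le (Real.cos_nonneg_of_mem_Icc ⟨?_, ?_⟩)
    · linarith [Complex.neg_pi_lt_arg y]
    · linarith [Complex.arg_le_pi y]
  refine ⟨Or.inl hre, ?_, ?_⟩
  · rw [← hsq, pow_two, Complex.mul_re] at hre
    exact abs_lt_of_sq_lt_sq (by nlinarith) hqre
  · have h1 : ‖q‖ ^ 2 < 2 := by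
      rw [← norm_pow, hsq, hy]
      refine (norm_sub_le _ _).trans_lt ?_
      simp; linarith
    nlinarith [norm_nonneg q]

theorem differentiableOn_snd_fiber {Ω : Set ((Fin m → ℂ) × (Fin n → ℂ))}
    {f : (Fin m → ℂ) × (Fin n → ℂ) → (Fin m → ℂ) × (Fin n → ℂ)} (hf : DifferentiableOn ℂ f Ω)
    (z : Fin m → ℂ) : DifferentiableOn ℂ (fun w => (f (z, w)).2) (fiber Ω z) := by
  have h : Differentiable ℂ fun w : Fin n → ℂ => (z, w) := by fun_prop
  have hm : MapsTo (fun w : Fin n → ℂ => (z, w)) (fiber Ω z) Ω := fun w hw => hw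
  exact (hf.comp h.differentiableOn hm).snd

/-- In the directions of sectors contained in `D` the diagonal derivatives of the fiber component
along the zero section are equal to one. -/
theorem deriv_snd_eq_one_of_sector {D : Set (Fin m → ℂ)} {p : Fin m → ℂ} (hp : p ∉ D)
    {Ω : Set ((Fin m → ℂ) × (Fin n → ℂ))} (hΩ : IsReinhardtFibered D Ω)
    (hcone : SatisfiesConeCondition D p Ω)
    {f : (Fin m → ℂ) × (Fin n → ℂ) → (Fin m → ℂ) × (Fin n → ℂ)}
    (hf : DifferentiableOn ℂ f Ω)
    (hfib : ∀ z ∈ D, MapsTo (fun w => (f (z, w)).2) (fiber Ω z) (fiber Ω z))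
    (hlim : EqIdAddLittleONontangential Ω (p, 0) 3 f) {ν : Fin m → ℂ} {ε t₁ : ℝ} (hε : 0 < ε)
    (ht₁ : 0 < t₁) (hsec : ∀ ν' : Fin m → ℂ, ‖ν' - ν‖ < ε →
      ∀ σ : ℂ, |σ.im| < σ.re → ‖σ‖ < t₁ → p + σ • ν' ∈ D) (i : Fin n) :
    deriv (fun t : ℂ => (f (p + ((t₁ / 2 : ℝ) : ℂ) • ν, Pi.single i t)).2 i) 0 = 1 := by
  have hpΩ : (p, (0 : Fin n → ℂ)) ∉ Ω := fun h => hp (hΩ.2.1 _ h)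
  have hsecν := hsec ν (by simpa using hε)
  set t₀ := t₁ / 2 with ht₀
  have ht₀pos : 0 < t₀ := by positivity
  have hreal : ∀ τ : ℝ, 0 < τ → τ < t₁ → ∀ ν' : Fin m → ℂ, ‖ν' - ν‖ < ε →
      p + (τ : ℂ) • ν' ∈ D := fun τ h0 h1 ν' hν' =>
    hsec ν' hν' τ (by simpa using h0) (by
      rwa [Complex.norm_real, Real.norm_of_nonneg h0.le])
  have hsingle : Differentiable ℂ (fun t : ℂ => (Pi.single i t : Fin n → ℂ)) :=
    (ContinuousLinearMap.single ℂ (fun _ : Fin n => ℂ) i).differentiable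
  set F : ℂ × ℂ → ℂ := fun x => (f (p + x.1 • ν, Pi.single i x.2)).2 i with hF
  set φ : ℂ → ℂ := fun σ => deriv (fun t => F (σ, t)) 0 with hφ
  have hmap : Differentiable ℂ
      (fun x : ℂ × ℂ => (p + x.1 • ν, (Pi.single i x.2 : Fin n → ℂ))) :=
    ((differentiable_fst.smul_const ν).const_add p).prodMk (hsingle.comp differentiable_snd)
  have hFd : DifferentiableOn ℂ F
      ((fun x : ℂ × ℂ => (p + x.1 • ν, (Pi.single i x.2 : Fin n → ℂ))) ⁻¹' Ω) :=
    differentiableOn_pi.1 (hf.comp hmap.differentiableOn fun x hx => hx).snd i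
  have hφd : DifferentiableOn ℂ φ {σ | p + σ • ν ∈ D} := by
    refine differentiableOn_deriv_snd (hΩ.1.1.preimage hmap.continuous) hFd fun σ hσ => ?_
    have := (hΩ.2.2 _ hσ).zero_mem
    simpa [fiber] using this
  have hφ1 : ∀ σ, p + σ • ν ∈ D → ‖φ σ‖ ≤ 1 := fun σ hσ =>
    (hΩ.2.2 _ hσ).norm_deriv_le_one (h := fun w => (f (p + σ • ν, w)).2)
      (differentiableOn_snd_fiber hf _) (hfib _ hσ) i
  -- third order contact gives `φ = 1 + o(τ ^ 2)` along the real ray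
  have hφo : ∀ e > 0, ∃ s > 0, ∀ τ : ℝ, 0 < τ → τ < s → ‖1 - φ τ‖ ≤ e * τ ^ 2 := by
    intro e he
    have hz₁ : p + (t₀ : ℂ) • ν ∈ D := hreal t₀ ht₀pos (by linarith) ν (by simpa using hε)
    obtain ⟨A, d, hd, hAd, hA⟩ := hcone.exists_linearMap hΩ hz₁
    have hAν : ∀ (τ : ℝ) (j : Fin n), 0 < τ → ‖A ((τ : ℂ) • ν) j‖ = τ * (d / t₀) := by
      intro τ j hτ
      have h1 := hAd j
      rw [add_sub_cancel_left, map_smul, Pi.smul_apply, smul_eq_mul] at h1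
      rw [map_smul, Pi.smul_apply, smul_eq_mul, norm_mul, Complex.norm_real,
        Real.norm_of_nonneg hτ.le]
      congr 1
      have h2 := congrArg norm h1
      rw [norm_mul, Complex.norm_real, Complex.norm_real, Real.norm_of_nonneg hd.le,
        Real.norm_of_nonneg ht₀pos.le] at h2
      rw [eq_div_iff ht₀pos.ne']; linarith
    set κ := (‖ν‖ + 1) / ε with hκ
    set β := d / t₀ / (‖ν‖ + 1) with hβ
    obtain ⟨κ', hκ'⟩ := exists_aperture hp hpΩ A hA (show 0 < κ by positivity)
      (show 0 < β by positivity)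
    set C := (1 + ‖A‖) * (‖ν‖ + 1) with hC
    have hCpos : 0 < C := by positivity
    -- Half of `‖A (τ • ν) j‖ / τ`: the axis discs of radius `c * τ` lie well inside the cone over
    -- `p + τ • ν`.
    set c := d / t₀ / 2 with hc
    have hcpos : 0 < c := by positivity
    obtain ⟨ρ, hρ, hfρ⟩ := eqIdAddLittleONontangential_iff.1 hlim κ' (e * c / C ^ 3) (by positivity)
    refine ⟨min t₁ (ρ / C), by positivity, fun τ hτ hτs => ?_⟩
    have hτ1 : τ < t₁ := hτs.trans_le (min_le_left _ _)
    have hτ2 : τ * C < ρ := (lt_div_iff₀ hCpos).1 (hτs.trans_le (min_le_right _ _))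
    set ζ := p + (τ : ℂ) • ν with hζ
    have hζp : ζ - p = (τ : ℂ) • ν := by rw [hζ, add_sub_cancel_left]
    have hζn : ‖ζ - p‖ = τ * ‖ν‖ := by
      rw [hζp, norm_smul, Complex.norm_real, Real.norm_of_nonneg hτ.le]
    have hζD : ζ ∈ D := hreal τ hτ hτ1 ν (by simpa using hε)
    have hreg : ζ ∈ approachRegion D p κ := by
      refine ⟨hζD, ?_⟩
      -- The directions within `ε` of `ν`, taken at parameter `τ`, fill the ball of radius `τ * ε`
      -- about `ζ`.
      have hinf : τ * ε ≤ Metric.infDist ζ Dᶜ := by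
        refine (Metric.le_infDist ⟨p, hp⟩).2 fun y hy => ?_
        by_contra hlt
        push Not at hlt
        have hτ0 : (τ : ℂ) ≠ 0 := by exact_mod_cast hτ.ne'
        refine hy ?_
        have hyD := hreal τ hτ hτ1 ((τ : ℂ)⁻¹ • (y - p)) (by
          have e1 : (τ : ℂ)⁻¹ • (y - p) - ν = (τ : ℂ)⁻¹ • (y - ζ) := by
            rw [hζ, ← sub_sub, smul_sub _ (y - p), smul_smul, inv_mul_cancel₀ hτ0, one_smul]
          rw [e1, norm_smul, norm_inv, Complex.norm_real, Real.norm_of_nonneg hτ.le,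
            ← dist_eq_norm, dist_comm, inv_mul_lt_iff₀ hτ]
          exact hlt)
        rwa [smul_smul, mul_inv_cancel₀ hτ0, one_smul, add_sub_cancel] at hyD
      rw [hζn]
      calc τ * ‖ν‖ ≤ τ * (‖ν‖ + 1) := by gcongr; linarith
        _ = κ * (τ * ε) := by rw [hκ]; field_simp
        _ ≤ _ := by gcongr
    have hlow : ∀ j, β * ‖ζ - p‖ ≤ ‖A (ζ - p) j‖ := by
      intro j
      rw [hζn, hζp, hAν τ j hτ]
      calc β * (τ * ‖ν‖) ≤ β * (τ * (‖ν‖ + 1)) := by gcongr; linarith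
        _ = τ * (d / t₀) := by rw [hβ]; field_simp
    have hpt : ∀ t : ℂ, ‖t‖ ≤ c * τ → ∀ j, ‖(Pi.single i t : Fin n → ℂ) j‖ ≤
        1 / 2 * ‖A (ζ - p) j‖ := by
      intro t ht j
      have h1 : 1 / 2 * ‖A (ζ - p) j‖ = c * τ := by rw [hζp, hAν τ j hτ, hc]; ring
      rw [h1]
      rcases eq_or_ne j i with rfl | hj
      · simpa using ht
      · simp [hj]; positivity
    have hFz : DifferentiableOn ℂ (fun t => F (τ, t)) (Metric.closedBall 0 (c * τ)) := by
      refine hFd.comp (by fun_prop) fun t ht => ?_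
      rw [mem_closedBall_zero_iff] at ht
      refine hA ζ hζD _ fun j => ?_
      have h1 := hpt t ht j
      have := norm_nonneg (A (ζ - p) j)
      linarith
    have hcτ : 0 < c * τ := by positivity
    -- Cauchy's estimate on a circle of radius `c * τ` turns the bound `e * c * τ ^ 3` into `e * τ ^
    -- 2`.
    have hbd := Complex.norm_deriv_le_of_forall_mem_sphere_norm_le (c := (0 : ℂ))
      (f := fun t => F (τ, t) - t) (R := c * τ) (C := e * c * τ ^ 3) hcτ
      ((hFz.sub differentiableOn_id).diffContOnCl_ball subset_rfl) (by
        intro t ht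
        rw [mem_sphere_zero_iff_norm] at ht
        obtain ⟨hmem, hnorm⟩ := hκ' ζ hreg (Pi.single i t) hlow (hpt t ht.le)
        have hnorm' : ‖(ζ, (Pi.single i t : Fin n → ℂ)) - (p, (0 : Fin n → ℂ))‖ ≤ C * τ := by
          refine hnorm.trans ?_
          rw [hζn, hC, mul_assoc, mul_comm τ]
          gcongr
          linarith
        have h1 := hfρ _ hmem (by linarith)
        have h2 : ‖F (τ, t) - t‖ ≤ ‖f (ζ, Pi.single i t) - (ζ, Pi.single i t)‖ := by
          have h3 := norm_le_pi_norm (f (ζ, Pi.single i t) - (ζ, Pi.single i t)).2 i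
          have h4 := norm_snd_le (f (ζ, Pi.single i t) - (ζ, Pi.single i t))
          refine le_trans (le_of_eq ?_) (h3.trans h4)
          simp [hF, hζ]
        refine h2.trans (h1.trans ?_)
        calc _ ≤ e * c / C ^ 3 * (C * τ) ^ 3 := by gcongr
          _ = e * c * τ ^ 3 := by field_simp)
    have hdat : DifferentiableAt ℂ (fun t => F (τ, t)) 0 :=
      hFz.differentiableAt (Metric.closedBall_mem_nhds _ hcτ)
    have hder : deriv (fun t => F (τ, t) - t) 0 = φ τ - 1 := by
      have := hdat.hasDerivAt.sub (hasDerivAt_id (0 : ℂ))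
      exact this.deriv
    rw [hder] at hbd
    rw [norm_sub_rev]
    refine hbd.trans_eq ?_
    field_simp
  set q : ℂ → ℂ := fun x => (1 - x) ^ (1 / 2 : ℂ) with hq
  have hqD : ∀ x ∈ Metric.ball (0 : ℂ) 1, p + ((t₀ : ℂ) * q x) • ν ∈ D := by
    intro x hx
    obtain ⟨-, h2, h3⟩ := sqrt_mem_sector hx
    refine hsecν _ ?_ ?_
    · rw [Complex.re_ofReal_mul, Complex.im_ofReal_mul, abs_mul, abs_of_pos ht₀pos]
      exact mul_lt_mul_of_pos_left h2 ht₀pos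
    · rw [norm_mul, Complex.norm_real, Real.norm_of_nonneg ht₀pos.le]
      calc t₀ * ‖q x‖ < t₀ * 2 := mul_lt_mul_of_pos_left h3 ht₀pos
        _ = t₁ := by rw [ht₀]; ring
  have hqd : DifferentiableOn ℂ q (Metric.ball 0 1) := fun x hx =>
    ((differentiableAt_id.const_sub 1).cpow_const (sqrt_mem_sector hx).1).differentiableWithinAt
  -- At `x = 1 - t` the parameter is `τ = t₀ * √t`, so `o(τ ^ 2)` is exactly the `o(t)` required;
  -- the centre `x = 0` corresponds to `t₀`.
  have hzero := re_eq_zero_of_isLittleO (G := fun x => 1 - φ (t₀ * q x))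
    ((hφd.comp (hqd.const_mul _) hqD).const_sub 1) (by
      intro x hx
      have h1 := hφ1 _ (hqD x hx)
      have h2 := Complex.re_le_norm (φ (t₀ * q x))
      simp only [Complex.sub_re, Complex.one_re]
      linarith) (by
      rw [isLittleO_iff]
      intro e he
      obtain ⟨s, hs, hφs⟩ := hφo (e / t₀ ^ 2) (by positivity)
      have hev : Ioo (0 : ℝ) ((s / t₀) ^ 2) ∈ 𝓝[>] (0 : ℝ) := Ioo_mem_nhdsGT (by positivity)
      filter_upwards [hev] with t ht
      have e1 : q (1 - t) = ((Real.sqrt t : ℝ) : ℂ) := by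
        simp only [hq, sub_sub_cancel]
        rw [Real.sqrt_eq_rpow, Complex.ofReal_cpow ht.1.le]
        push_cast
        rfl
      have h1 : t₀ * Real.sqrt t < s := by
        have := Real.sqrt_lt_sqrt ht.1.le ht.2
        rw [Real.sqrt_sq (by positivity), lt_div_iff₀ ht₀pos] at this
        linarith
      have h2 := hφs (t₀ * Real.sqrt t) (mul_pos ht₀pos (Real.sqrt_pos.2 ht.1)) h1
      rw [e1, ← Complex.ofReal_mul, Real.norm_of_nonneg ht.1.le]
      refine h2.trans_eq ?_
      rw [mul_pow, Real.sq_sqrt ht.1.le]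
      field_simp)
  have hq0 : q 0 = 1 := by simp [hq]
  simp only [hq0, mul_one, Complex.sub_re, Complex.one_re] at hzero
  have hn := hφ1 t₀ (by simpa [hq0] using hqD 0 (by simp))
  have hre : (φ t₀).re = 1 := by linarith
  have hsq : ‖φ t₀‖ ^ 2 ≤ 1 := by nlinarith [norm_nonneg (φ t₀)]
  rw [← Complex.normSq_eq_norm_sq, Complex.normSq_apply, hre] at hsq
  have him : (φ t₀).im = 0 := by nlinarith [mul_self_nonneg (φ t₀).im]
  exact Complex.ext (z := φ t₀) (w := 1) hre him

end BurnsKrantz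

/-! ### Conclusion on an open set of base points -/

theorem mainTheorem12 (m n : ℕ)
    (D : Set (Fin m → ℂ)) (hD : BurnsKrantz.IsDomainSet D)
    (p : Fin m → ℂ) (hp : p ∈ frontier D)
    (hC1 : BurnsKrantz.HasC1BoundaryNear D p)
    (hrigid : BurnsKrantz.NontangentialRigidityAt D p)
    (Ω : Set ((Fin m → ℂ) × (Fin n → ℂ)))
    (hΩ : BurnsKrantz.IsReinhardtFibered D Ω)
    (hcone : BurnsKrantz.SatisfiesConeCondition D p Ω)
    (f : (Fin m → ℂ) × (Fin n → ℂ) → (Fin m → ℂ) × (Fin n → ℂ))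
    (hf : DifferentiableOn ℂ f Ω) (hmaps : MapsTo f Ω Ω)
    (hlim : BurnsKrantz.EqIdAddLittleONontangential Ω (p, 0) 3 f) :
    ∀ x ∈ Ω, f x = x := by
  have hpD : p ∉ D := fun h => by
    rw [frontier, hD.1.interior_eq] at hp
    exact hp.2 h
  have hfst := BurnsKrantz.fst_eq_of_nontangentialRigidityAt hD hpD hrigid hΩ hcone hf hmaps hlim
  have hfib : ∀ z ∈ D, MapsTo (fun w => (f (z, w)).2) (BurnsKrantz.fiber Ω z)
      (BurnsKrantz.fiber Ω z) := by
    intro z _ w hw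
    have h1 : f (z, w) ∈ Ω := hmaps hw
    have h2 : (f (z, w)).1 = z := hfst _ hw
    have h3 : f (z, w) = (z, (f (z, w)).2) := Prod.ext h2 rfl
    rw [h3] at h1
    exact h1
  obtain ⟨ν₀, ε, t₁, hε, ht₁, hsec⟩ := hC1.exists_sector (frontier_subset_closure hp)
  set t₀ : ℂ := ((t₁ / 2 : ℝ) : ℂ) with ht₀
  have ht₀n : ‖t₀‖ = t₁ / 2 := by
    rw [ht₀, Complex.norm_real, Real.norm_of_nonneg (by positivity)]
  have ht₀ne : t₀ ≠ 0 := norm_pos_iff.1 (by rw [ht₀n]; positivity)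
  -- Each such `z` is the point at parameter `t₁ / 2` of its own ray from `p`; radius `ε / 2` leaves
  -- the room `ε / 2` around that direction needed for non-tangential approach.
  have hid : ∀ z, ‖t₀⁻¹ • (z - p) - ν₀‖ < ε / 2 → ∀ w, (z, w) ∈ Ω → f (z, w) = (z, w) := by
    intro z hz w hw
    have hzD : z ∈ D := hΩ.2.1 _ hw
    set ν := t₀⁻¹ • (z - p) with hν
    have hzν : p + t₀ • ν = z := by
      rw [hν, smul_smul, mul_inv_cancel₀ ht₀ne, one_smul, add_sub_cancel]
    have hone := BurnsKrantz.deriv_snd_eq_one_of_sector hpD hΩ hcone hf hfib hlim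
      (ν := ν) (ε := ε / 2) (t₁ := t₁) (by positivity) ht₁ (fun ν' hν' => hsec ν' (by
        have e : ν' - ν₀ = (ν' - ν) + (ν - ν₀) := by abel
        rw [e]
        exact (norm_add_le _ _).trans_lt (by linarith)))
    rw [← ht₀, hzν] at hone
    have := (hΩ.2.2 z hzD).eqOn_id_of_deriv_eq_one (h := fun w => (f (z, w)).2)
      (BurnsKrantz.differentiableOn_snd_fiber hf z) (hfib z hzD) hone hw
    exact Prod.ext (hfst _ hw) this
  have hz₁ : p + t₀ • ν₀ ∈ D := hsec ν₀ (by simpa using hε) t₀ (by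
    rw [ht₀, Complex.ofReal_im, Complex.ofReal_re, abs_zero]; positivity) (by
    rw [ht₀n]; linarith)
  have hx₁ : (p + t₀ • ν₀, (0 : Fin n → ℂ)) ∈ Ω := (hΩ.2.2 _ hz₁).zero_mem
  refine BurnsKrantz.eqOn_of_isPreconnected_of_eventuallyEq (g := id) hΩ.1.1
    hΩ.1.2.isPreconnected hf differentiableOn_id hx₁ ?_
  have hev : ∀ᶠ x : (Fin m → ℂ) × (Fin n → ℂ) in 𝓝 (p + t₀ • ν₀, 0),
      ‖t₀⁻¹ • (x.1 - p) - ν₀‖ < ε / 2 := by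
    have hcont : Continuous fun x : (Fin m → ℂ) × (Fin n → ℂ) => ‖t₀⁻¹ • (x.1 - p) - ν₀‖ := by
      fun_prop
    refine (hcont.tendsto _).eventually (gt_mem_nhds ?_)
    simp only [add_sub_cancel_left, smul_smul, inv_mul_cancel₀ ht₀ne, one_smul, sub_self, norm_zero]
    positivity
  filter_upwards [hev, hΩ.1.1.mem_nhds hx₁] with x hx hxΩ
  exact hid x.1 hx x.2 hxΩ
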